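/- Conventions. $L_s$ ($1\le s\le\infty$) is the space of real $2\pi$-periodic functions with $\|f\|_s=\big(\int_0^{2\pi}|f(t)|^s\,dt\big)^{1/s}<\infty$ for $s<\infty$ and $\|f\|_\infty=\operatorname{ess\,sup}|f|<\infty$; $C$ is the space of continuous real $2\pi$-periodic functions with $\|f\|_C=\max_t|f(t)|$. For $f\in L_1$ let $a_k,b_k$ be its Fourier coefficients, $S_k(f;x)=\frac{a_0}{2}+\sum_{j=1}^{k}(a_j\cos jx+b_j\sin jx)$, and for $n,p\in\mathbb N$, $p\le n$, $$V_{n,p}(f;x)=\frac1p\sum_{k=n-p}^{n-1}S_k(f;x),\qquad \rho_{n,p}(f;x)=f(x)-V_{n,p}(f;x).$$ Let $0<q<1$, $\psi(k)=q^k/k$ ($k\ge1$; the coefficients of the Neumann kernel $\sum_{k\ge1}\frac{q^k}{k}\cos(kt-\frac{\beta\pi}{2})$) and $\beta\in\mathbb R$. If $\sum_{k\ge1}\frac1{\psi(k)}\big(a_k\cos(kx+\frac{\beta\pi}2)+b_k\sin(kx+\frac{\beta\pi}2)\big)$ is the Fourier series of a function in $L_1$, this function is denoted by $f^\psi_\beta$;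 $C^\psi_\beta L_s$ is the set of $f\in C$ for which $f^\psi_\beta$ exists and belongs to $L_s$. $E_m(\varphi)_{L_s}$ is the infimum of $\|\varphi-t\|_s$ over trigonometric polynomials $t$ of order at most $m-1$. For $\frac1s+\frac1{s'}=1$ put $$K_{q,p}(u)=2^{-1/u}\left\|\frac{\sqrt{1-2q^p\cos pt+q^{2p}}}{1-2q\cos t+q^2}\right\|_u\quad(1\le u\le\infty),$$ $\sigma(u,p)=1$ if $u=1,p=1$; $\sigma(u,p)=2$ if $1<u\le\infty$, $p=1$; $\sigma(u,p)=3$ if $p\ge2$; $\delta(2)=0$ and $\delta(s)=1$ for $s\ne2$. Statement. (i) For every $q\in(0,1)$ and $m\ge1$, $$\varepsilon_m:=\sup_{k\ge m}\left|\frac{\psi(k+1)}{\psi(k)}-q\right|=\frac{q}{m+1}.$$ (ii) There is an absolute constant $A>0$ such that for all $q\in(0,1)$, $\beta\in\mathbb R$, $1\le s\le\infty$, $n,p\in\mathbb N$ with $p\le n$, and all $f\in C^\psi_\beta L_s$, $$\|\rho_{n,p}(f)\|_C\le\frac{q^{n-p+1}}{p(n-p+1)}\Big(\frac{\|\cos t\|_{s'}}{\pi^{1+1/s'}}K_{q,p}(s')+A\,R\Big)E_{n-p+1}(f^\psi_\beta)_{L_s},$$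 $$R=\frac{q\,\delta(s)}{(n-p+1)(1-q)^{\sigma(s',p)}}+\frac{q}{(n-p+2)(1-q)^2}\min\Big\{p,\frac1{1-q}\Big\}.$$ Moreover, for all these parameters and every $f\in C^\psi_\beta L_s$ there exist a function $F\in C^\psi_\beta L_s$ (depending on $f,n,p$ and on $q,\beta,s$) with $E_{n-p+1}(F^\psi_\beta)_{L_s}=E_{n-p+1}(f^\psi_\beta)_{L_s}$, and a real number $\theta$ with $|\theta|\le A$, such that $$\|\rho_{n,p}(F)\|_C=\frac{q^{n-p+1}}{p(n-p+1)}\Big(\frac{\|\cos t\|_{s'}}{\pi^{1+1/s'}}K_{q,p}(s')+\theta\,R\Big)E_{n-p+1}(F^\psi_\beta)_{L_s}.$$ (This equality is the sense in which the inequality is asymptotically sharp as $n-p\to\infty$.) -/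

import Mathlib

open Real MeasureTheory
open scoped ENNReal

noncomputable section

namespace VallePoussin

/-- Lebesgue measure on one period. -/
def periodMeasure : Measure ℝ := volume.restrict (Set.Ioc 0 (2 * π))

/-- The norm `‖f‖_s` over one period (not normalised); `s = ∞` gives the essential supremum. -/
def normL (s : ℝ≥0∞) (f : ℝ → ℝ) : ℝ := (eLpNorm f s periodMeasure).toReal

/-- `f` belongs to the space `L_s` of `2π`-periodic functions. -/
def MemL (s : ℝ≥0∞) (f : ℝ → ℝ) : Prop :=
  Function.Periodic f (2 * π) ∧ MemLp f s periodMeasure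

/-- `f` belongs to the space `C` of continuous `2π`-periodic functions. -/
def MemC (f : ℝ → ℝ) : Prop :=
  Function.Periodic f (2 * π) ∧ Continuous f

/-- The uniform norm. -/
def normC (f : ℝ → ℝ) : ℝ := ⨆ x : ℝ, |f x|

/-- Fourier cosine coefficient `a_k(f)`. -/
def fourierA (f : ℝ → ℝ) (k : ℕ) : ℝ := (1 / π) * ∫ t in (0)..(2 * π), f t * cos (k * t)

/-- Fourier sine coefficient `b_k(f)`. -/
def fourierB (f : ℝ → ℝ) (k : ℕ) : ℝ := (1 / π) * ∫ t in (0)..(2 * π), f t * sin (k * t)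

/-- The Fourier partial sum `S_k(f; x)` of order `k`. -/
def partialSum (k : ℕ) (f : ℝ → ℝ) (x : ℝ) : ℝ :=
  fourierA f 0 / 2 +
    ∑ j ∈ Finset.Icc 1 k, (fourierA f j * cos (j * x) + fourierB f j * sin (j * x))

/-- The de la Vallée Poussin sum `V_{n,p}(f; x) = (1/p) ∑_{k=n-p}^{n-1} S_k(f; x)`. -/
def vpSum (n p : ℕ) (f : ℝ → ℝ) (x : ℝ) : ℝ :=
  (1 / (p : ℝ)) * ∑ k ∈ Finset.Ico (n - p) n, partialSum k f x

/-- The deviation `ρ_{n,p}(f; x) = f(x) - V_{n,p}(f; x)`. -/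
def deviation (n p : ℕ) (f : ℝ → ℝ) (x : ℝ) : ℝ := f x - vpSum n p f x

/-- `φ` is a `(ψ, β)`-derivative of `f`: it is a `2π`-periodic summable function whose Fourier
series is, term by term,
`∑_{k ≥ 1} (1/ψ(k)) (a_k cos(kx + βπ/2) + b_k sin(kx + βπ/2))`,
where `a_k, b_k` are the Fourier coefficients of `f`. -/
def IsPsiDeriv (ψ : ℕ → ℝ) (β : ℝ) (f φ : ℝ → ℝ) : Prop :=
  MemL 1 φ ∧ fourierA φ 0 = 0 ∧
    ∀ k : ℕ, 1 ≤ k → ∀ x : ℝ,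
      fourierA φ k * cos (k * x) + fourierB φ k * sin (k * x) =
        (1 / ψ k) * (fourierA f k * cos (k * x + β * π / 2) +
          fourierB f k * sin (k * x + β * π / 2))

/-- `f` belongs to `C_β^ψ L_s`, and `φ ∈ L_s` is its `(ψ, β)`-derivative (which is
determined by `f` up to equality almost everywhere). -/
def MemCPsi (ψ : ℕ → ℝ) (β : ℝ) (s : ℝ≥0∞) (f φ : ℝ → ℝ) : Prop :=
  MemC f ∧ IsPsiDeriv ψ β f φ ∧ MemL s φ

/-- A trigonometric polynomial of order at most `m - 1`, with coefficients `a, b`. -/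
def trigPoly (m : ℕ) (a b : ℕ → ℝ) (x : ℝ) : ℝ :=
  ∑ k ∈ Finset.range m, (a k * cos (k * x) + b k * sin (k * x))

/-- The best approximation `E_m(φ)_{L_s}` by trigonometric polynomials of order at most
`m - 1` in the metric of `L_s`. -/
def bestApprox (m : ℕ) (s : ℝ≥0∞) (φ : ℝ → ℝ) : ℝ :=
  sInf {r : ℝ | ∃ a b : ℕ → ℝ, r = normL s (fun x => φ x - trigPoly m a b x)}

/-- The number `1/u` for `u ∈ [1, ∞]`, with `1/∞ = 0`. -/
def recip (u : ℝ≥0∞) : ℝ := (u⁻¹).toReal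

/-- `K_{q,p}(u)`. -/
def Kqp (q : ℝ) (p : ℕ) (u : ℝ≥0∞) : ℝ :=
  (2 : ℝ) ^ (-recip u) *
    normL u (fun t => √(1 - 2 * q ^ p * cos (p * t) + q ^ (2 * p)) /
      (1 - 2 * q * cos t + q ^ 2))

/-- The exponent `σ(u, p)`. -/
def sigmaExp (u : ℝ≥0∞) (p : ℕ) : ℕ :=
  if p = 1 then (if u = 1 then 1 else 2) else 3

/-- `δ(s)`. -/
def deltaS (s : ℝ≥0∞) : ℝ := if s = 2 then 0 else 1

/-- The coefficients `ψ(k) = q^k / k` (for `k ≥ 1`) of the Neumann kernel. -/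
def neumann (q : ℝ) (k : ℕ) : ℝ := q ^ k / k

/-- The main constant `‖cos t‖_{s'} / π^{1 + 1/s'} · K_{q,p}(s')`, as a function of `u = s'`. -/
def mainConst (q : ℝ) (p : ℕ) (u : ℝ≥0∞) : ℝ :=
  normL u cos / π ^ (1 + recip u) * Kqp q p u

/-- The quantity multiplied by `O(1)`; here `s'` is the conjugate exponent of `s`. -/
def remainder (q : ℝ) (n p : ℕ) (s : ℝ≥0∞) : ℝ :=
  q * deltaS s /
      (((n - p + 1 : ℕ) : ℝ) * (1 - q) ^ sigmaExp (ENNReal.conjExponent s) p) +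
    q / (((n - p + 2 : ℕ) : ℝ) * (1 - q) ^ 2) * min (p : ℝ) (1 / (1 - q))

end VallePoussin

end

noncomputable section

namespace VallePoussin

/-! Put `m = n - p + 1` and `γ = βπ/2`. A function of the class is its mean value plus the
convolution of its derivative `φ` with the Neumann kernel, so the deviation is `1/(πp)` times the
convolution of `φ` with `devKernel`, in which the harmonic `m + i` carries the weight `min(i+1, p)`,
the number of the `p` partial sums that omit it (`deviation_eq_integral`). The kernel has no
harmonics below `m`, hence `φ` may be replaced by `φ` minus any polynomial of order at most `m - 1`,
and Hölder's inequality bounds the deviation by the `L_{s'}` norm of the kernel times the best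
approximation of `φ`. Near-extremal functions for Hölder, rescaled to have the prescribed best
approximation, show that this bound is sharp up to an arbitrary `ε` (`exists_deviation_ge`).

It remains to compute the norm of the kernel. Replacing `1/(m+i)` by `1/m` costs the second term of
the remainder and leaves `q^m/m` times `Re(e^{i(mt-γ)} g(t))`, where `g = (1-z^p)/(1-z)^2` at `z = q
e^{it}` (`abs_devKernel_sub_le`). Shifting `t` by `θ/m` changes the phase by `θ` and barely moves
`g`; averaging over `θ` separates the cosine from `g` exactly. Hence the norm is `(2π)^{-1/u}
‖cos‖_u ‖g‖_u` up to the `L_u` modulus of continuity of `g` at step `2π/m`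
(`abs_normL_oscillation_sub_main_le`), which gives the first term of the remainder. For `u = 2` this
error vanishes, because the square of the analytic signal has integral zero by Cauchy's theorem. -/

lemma two_pi_fact : Fact (0 < 2 * π) := ⟨two_pi_pos⟩

attribute [local instance] two_pi_fact

/-! ### Norms over one period: shifts, reflections and perturbations. -/

lemma periodMeasure_univ : periodMeasure Set.univ = ENNReal.ofReal (2 * π) := by
  simp [periodMeasure]

instance : IsFiniteMeasure periodMeasure := ⟨by rw [periodMeasure_univ]; exact ENNReal.ofReal_lt_top⟩

lemma intervalIntegral_eq_periodMeasure {E : Type*} [NormedAddCommGroup E] [NormedSpace ℝ E]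
    (f : ℝ → E) : ∫ t in (0)..(2 * π), f t = ∫ t, f t ∂periodMeasure := by
  rw [intervalIntegral.integral_of_le two_pi_pos.le, periodMeasure]

lemma exists_bound_of_continuous_periodic {E : Type*} [NormedAddCommGroup E] {f : ℝ → E}
    (hf : Continuous f) (hp : Function.Periodic f (2 * π)) : ∃ C, 0 ≤ C ∧ ∀ t, ‖f t‖ ≤ C := by
  obtain ⟨C, hC⟩ := (isCompact_Icc (a := (0 : ℝ)) (b := 2 * π)).exists_bound_of_continuousOn
    hf.continuousOn
  refine ⟨C, (norm_nonneg _).trans (hC 0 ⟨le_rfl, two_pi_pos.le⟩), fun t => ?_⟩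
  obtain ⟨y, hy, hty⟩ := hp.exists_mem_Ico₀ two_pi_pos t
  rw [hty]
  exact hC y ⟨hy.1, hy.2.le⟩

lemma memLp_of_continuous_periodic {E : Type*} [NormedAddCommGroup E] {f : ℝ → E}
    (hf : Continuous f) (hp : Function.Periodic f (2 * π)) (u : ℝ≥0∞) :
    MemLp f u periodMeasure := by
  obtain ⟨C, -, hC⟩ := exists_bound_of_continuous_periodic hf hp
  exact MemLp.of_bound hf.aestronglyMeasurable C (.of_forall hC)

/-- The function descends to the circle, where translations and reflections preserve Haar measure;
this avoids cutting and regluing the period. -/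
lemma eLpNorm_comp_of_circle {E : Type*} [NormedAddCommGroup E] {f : ℝ → E}
    (hf : Continuous f) (hp : Function.Periodic f (2 * π)) (u : ℝ≥0∞)
    {σ : ℝ → ℝ} {S : AddCircle (2 * π) → AddCircle (2 * π)} (hS : MeasurePreserving S)
    (hσ : ∀ t : ℝ, S (t : AddCircle (2 * π)) = (σ t : AddCircle (2 * π))) :
    eLpNorm (fun t => f (σ t)) u periodMeasure = eLpNorm f u periodMeasure := by
  have hmk : MeasurePreserving (fun t : ℝ => (t : AddCircle (2 * π))) periodMeasure volume := by
    have := AddCircle.measurePreserving_mk (2 * π) 0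
    simpa [periodMeasure] using this
  have hc : Continuous (hp.lift : AddCircle (2 * π) → E) := continuous_coinduced_dom.mpr hf
  have hm : AEStronglyMeasurable (hp.lift : AddCircle (2 * π) → E) volume :=
    hc.aestronglyMeasurable
  have h1 : f = hp.lift ∘ (fun t : ℝ => (t : AddCircle (2 * π))) := by
    ext t; exact (hp.lift_coe t).symm
  have h2 : (fun t => f (σ t)) = hp.lift ∘ (S ∘ (fun t : ℝ => (t : AddCircle (2 * π)))) := by
    ext t
    simp only [Function.comp_apply, hσ]
    exact (hp.lift_coe _).symm
  rw [h2, eLpNorm_comp_measurePreserving hm (hS.comp hmk)]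
  conv_rhs => rw [h1]
  rw [eLpNorm_comp_measurePreserving hm hmk]

lemma eLpNorm_add_shift {E : Type*} [NormedAddCommGroup E] {f : ℝ → E}
    (hf : Continuous f) (hp : Function.Periodic f (2 * π)) (u : ℝ≥0∞) (τ : ℝ) :
    eLpNorm (fun t => f (t + τ)) u periodMeasure = eLpNorm f u periodMeasure :=
  eLpNorm_comp_of_circle hf hp u
    (measurePreserving_add_right volume (τ : AddCircle (2 * π))) (fun _ => by simp)

lemma eLpNorm_sub_left {E : Type*} [NormedAddCommGroup E] {f : ℝ → E}
    (hf : Continuous f) (hp : Function.Periodic f (2 * π)) (u : ℝ≥0∞) (x : ℝ) :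
    eLpNorm (fun t => f (x - t)) u periodMeasure = eLpNorm f u periodMeasure :=
  eLpNorm_comp_of_circle hf hp u
    (Measure.measurePreserving_sub_left volume (x : AddCircle (2 * π))) (fun _ => by simp)

/-- The factor `(2π)^{1/u}` is at most `2π` for every `u ≥ 1`; this uniformity in `u` is what allows
the final constant to be absolute. -/
lemma toReal_eLpNorm_le_of_bound {E : Type*} [NormedAddCommGroup E] {f : ℝ → E} {u : ℝ≥0∞}
    (hu : 1 ≤ u) {C : ℝ} (hC : 0 ≤ C) (h : ∀ t, ‖f t‖ ≤ C) :
    (eLpNorm f u periodMeasure).toReal ≤ 2 * π * C := by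
  have h1 := eLpNorm_le_of_ae_bound (p := u) (μ := periodMeasure) (f := f)
    (.of_forall h)
  have h2 : periodMeasure Set.univ ^ u.toReal⁻¹ ≤ ENNReal.ofReal (2 * π) := by
    rw [periodMeasure_univ]
    have h3 : (1 : ℝ≥0∞) ≤ ENNReal.ofReal (2 * π) := by
      rw [ENNReal.one_le_ofReal]; linarith [pi_gt_three]
    have h4 : u.toReal⁻¹ ≤ 1 := by
      rcases eq_or_ne u ⊤ with rfl | hu'
      · simp
      · apply inv_le_one_of_one_le₀
        rw [← ENNReal.toReal_one]
        exact ENNReal.toReal_mono hu' hu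
    calc _ ≤ ENNReal.ofReal (2 * π) ^ (1 : ℝ) := ENNReal.rpow_le_rpow_of_exponent_le h3 h4
      _ = _ := by simp
  have h5 := h1.trans (mul_le_mul_left h2 _)
  rw [← ENNReal.ofReal_mul two_pi_pos.le] at h5
  have h6 := ENNReal.toReal_mono ENNReal.ofReal_ne_top h5
  rwa [ENNReal.toReal_ofReal (by positivity)] at h6

lemma abs_toReal_eLpNorm_sub_le {E : Type*} [NormedAddCommGroup E] {f g : ℝ → E} {u : ℝ≥0∞}
    (hu : 1 ≤ u) (hf : MemLp f u periodMeasure) (hg : MemLp g u periodMeasure) :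
    |(eLpNorm f u periodMeasure).toReal - (eLpNorm g u periodMeasure).toReal| ≤
      (eLpNorm (fun t => f t - g t) u periodMeasure).toReal := by
  have key : ∀ {f g : ℝ → E}, MemLp f u periodMeasure → MemLp g u periodMeasure →
      (eLpNorm f u periodMeasure).toReal ≤ (eLpNorm (fun t => f t - g t) u periodMeasure).toReal
        + (eLpNorm g u periodMeasure).toReal := by
    intro f g hf hg
    have h := eLpNorm_add_le (hf.sub hg).1 hg.1 hu
    rw [sub_add_cancel] at h
    have h' := ENNReal.toReal_mono (ENNReal.add_ne_top.2 ⟨(hf.sub hg).2.ne, hg.2.ne⟩) h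
    rw [ENNReal.toReal_add (hf.sub hg).2.ne hg.2.ne] at h'
    exact h'
  have h1 := key hf hg
  have h2 := key hg hf
  have h3 : eLpNorm (fun t => g t - f t) u periodMeasure
      = eLpNorm (fun t => f t - g t) u periodMeasure := eLpNorm_sub_comm g f u periodMeasure
  rw [h3] at h2
  rw [abs_le]
  constructor <;> linarith

/-- By continuity, exceeding the essential supremum at `x` would mean exceeding it on an interval.
Translating `x` to `0` places a right half of that interval inside the period. -/
lemma norm_le_of_continuous_periodic {E : Type*} [NormedAddCommGroup E] {f : ℝ → E}
    (hf : Continuous f) (hp : Function.Periodic f (2 * π)) (x : ℝ) :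
    ‖f x‖ ≤ (eLpNorm f ∞ periodMeasure).toReal := by
  by_contra! h
  have hpos : 0 < periodMeasure
      {t | (eLpNorm f ∞ periodMeasure).toReal < ‖f (t + x)‖} := by
    have ho : IsOpen {t | (eLpNorm f ∞ periodMeasure).toReal < ‖f (t + x)‖} :=
      isOpen_lt continuous_const (by fun_prop)
    have h0 : (0 : ℝ) ∈ {t | (eLpNorm f ∞ periodMeasure).toReal < ‖f (t + x)‖} := by simpa using h
    obtain ⟨ε, hε, hb⟩ := Metric.isOpen_iff.1 ho 0 h0
    have hsub : Set.Ioo 0 (min ε (2 * π)) ⊆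
        {t | (eLpNorm f ∞ periodMeasure).toReal < ‖f (t + x)‖} ∩ Set.Ioc 0 (2 * π) := by
      intro t ht
      refine ⟨hb ?_, ht.1, (ht.2.trans_le (min_le_right _ _)).le⟩
      rw [Metric.mem_ball, Real.dist_eq, sub_zero, abs_of_pos ht.1]
      exact ht.2.trans_le (min_le_left _ _)
    rw [show periodMeasure = volume.restrict (Set.Ioc 0 (2 * π)) from rfl] at ho hsub ⊢
    rw [Measure.restrict_apply ho.measurableSet]
    refine lt_of_lt_of_le ?_ (measure_mono hsub)
    simp [hε, pi_pos]
  refine hpos.ne' ?_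
  have hae : ∀ᵐ t ∂periodMeasure, ‖f (t + x)‖ ≤ (eLpNorm f ∞ periodMeasure).toReal := by
    have hs := eLpNorm_add_shift hf hp ∞ x
    have hfin : eLpNorm f ∞ periodMeasure ≠ ⊤ := (memLp_of_continuous_periodic hf hp ∞).2.ne
    rw [← hs] at hfin ⊢
    rw [eLpNorm_exponent_top] at hfin ⊢
    filter_upwards [enorm_ae_le_eLpNormEssSup (fun t => f (t + x)) periodMeasure] with t ht
    have := ENNReal.toReal_mono hfin ht
    simpa using this
  have := ae_iff.1 hae
  simpa using this

/-! ### The norm of a rapidly oscillating function. -/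

/-- The real oscillation `Re (e^{i(mt - γ + θ)} g(t))`. -/
def oscillation (g : ℝ → ℂ) (m : ℕ) (γ θ t : ℝ) : ℝ :=
  (Complex.exp (((m * t - γ + θ : ℝ) : ℂ) * Complex.I) * g t).re

lemma exp_natCast_mul_periodic (m : ℕ) (c t : ℝ) :
    Complex.exp (((m * (t + 2 * π) + c : ℝ) : ℂ) * Complex.I) =
      Complex.exp (((m * t + c : ℝ) : ℂ) * Complex.I) := by
  rw [Complex.exp_eq_exp_iff_exists_int]
  exact ⟨m, by push_cast; ring⟩

lemma continuous_oscillation {g : ℝ → ℂ} (hg : Continuous g) (m : ℕ) (γ : ℝ) :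
    Continuous (Function.uncurry (oscillation g m γ)) := by
  unfold Function.uncurry oscillation
  fun_prop

lemma periodic_oscillation {g : ℝ → ℂ} (hp : Function.Periodic g (2 * π)) (m : ℕ) (γ θ : ℝ) :
    Function.Periodic (oscillation g m γ θ) (2 * π) := by
  intro t
  have h := exp_natCast_mul_periodic m (-γ + θ) t
  unfold oscillation
  rw [hp t, show (m * (t + 2 * π) - γ + θ : ℝ) = m * (t + 2 * π) + (-γ + θ) by ring, h]
  congr 5
  ring

lemma abs_oscillation_le (g : ℝ → ℂ) (m : ℕ) (γ θ t : ℝ) :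
    |oscillation g m γ θ t| ≤ ‖g t‖ := by
  refine (Complex.abs_re_le_norm _).trans ?_
  rw [norm_mul, Complex.norm_exp_ofReal_mul_I, one_mul]

lemma oscillation_eq_cos (g : ℝ → ℂ) (m : ℕ) (γ θ t : ℝ) :
    oscillation g m γ θ t = ‖g t‖ * cos (θ + (m * t - γ + Complex.arg (g t))) := by
  unfold oscillation
  conv_lhs => rw [← Complex.norm_mul_exp_arg_mul_I (g t)]
  rw [mul_left_comm, ← Complex.exp_add, ← add_mul, ← Complex.ofReal_add, Complex.re_ofReal_mul,
    Complex.exp_ofReal_mul_I_re]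
  congr 2; ring

/-- Translation by `θ/m` turns phase `0` into phase `θ` in the exponential, so only the displacement
of `g` by `θ/m ≤ 2π/m` is felt. -/
lemma abs_normL_oscillation_sub_le {g : ℝ → ℂ} (hg : Continuous g)
    (hp : Function.Periodic g (2 * π)) {m : ℕ} (hm : 1 ≤ m) (γ : ℝ) {u : ℝ≥0∞} (hu : 1 ≤ u)
    {D : ℝ} (hD : ∀ τ ∈ Set.Icc 0 (2 * π / m),
      (eLpNorm (fun t => g (t + τ) - g t) u periodMeasure).toReal ≤ D)
    {θ : ℝ} (hθ : θ ∈ Set.Icc 0 (2 * π)) :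
    |normL u (oscillation g m γ 0) - normL u (oscillation g m γ θ)| ≤ D := by
  have hm0 : (0 : ℝ) < m := by exact_mod_cast hm
  have hc : ∀ θ, Continuous (oscillation g m γ θ) := fun θ =>
    (continuous_oscillation hg m γ).comp (by fun_prop : Continuous fun t => (θ, t))
  have hP := fun θ => periodic_oscillation hp m γ θ
  have hs := eLpNorm_add_shift (hc 0) (hP 0) u (θ / m)
  have hτ : θ / m ∈ Set.Icc 0 (2 * π / m) :=
    ⟨div_nonneg hθ.1 hm0.le, div_le_div_of_nonneg_right hθ.2 hm0.le⟩
  refine le_trans ?_ (hD _ hτ)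
  unfold normL
  rw [← hs]
  have hmem : MemLp (fun t => oscillation g m γ 0 (t + θ / m)) u periodMeasure :=
    memLp_of_continuous_periodic ((hc 0).comp (by fun_prop)) ((hP 0).add_const _) u
  refine (abs_toReal_eLpNorm_sub_le hu hmem
    (memLp_of_continuous_periodic (hc θ) (hP θ) u)).trans ?_
  have hmem2 : MemLp (fun t => g (t + θ / m) - g t) u periodMeasure :=
    memLp_of_continuous_periodic ((hg.comp (by fun_prop)).sub hg)
      ((hp.add_const _).sub hp) u
  refine ENNReal.toReal_mono hmem2.2.ne (eLpNorm_mono fun t => ?_)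
  have : oscillation g m γ 0 (t + θ / m) - oscillation g m γ θ t =
      (Complex.exp (((m * t - γ + θ : ℝ) : ℂ) * Complex.I) * (g (t + θ / m) - g t)).re := by
    unfold oscillation
    rw [mul_sub, Complex.sub_re]
    congr 6
    have : (m : ℂ) ≠ 0 := by exact_mod_cast hm0.ne'
    field_simp
    ring
  rw [this, Real.norm_eq_abs]
  refine (Complex.abs_re_le_norm _).trans ?_
  rw [norm_mul, Complex.norm_exp_ofReal_mul_I, one_mul]

lemma periodic_cos_two_pi : Function.Periodic cos (2 * π) := cos_periodic

/-- Averaging the oscillation over all phases. -/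
lemma lintegral_oscillation {g : ℝ → ℂ} (hg : Continuous g) (m : ℕ) (γ : ℝ) {u : ℝ≥0∞}
    (hu : 1 ≤ u) (hu' : u ≠ ∞) :
    ∫⁻ θ, eLpNorm (oscillation g m γ θ) u periodMeasure ^ u.toReal ∂periodMeasure =
      (eLpNorm cos u periodMeasure * eLpNorm g u periodMeasure) ^ u.toReal := by
  have hu0 : u ≠ 0 := (zero_lt_one.trans_le hu).ne'
  have hr : 0 < u.toReal := ENNReal.toReal_pos hu0 hu'
  have hpow : ∀ {F : Type} [NormedAddCommGroup F] (f : ℝ → F),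
      eLpNorm f u periodMeasure ^ u.toReal = ∫⁻ t, ‖f t‖ₑ ^ u.toReal ∂periodMeasure := by
    intro F _ f
    rw [eLpNorm_eq_lintegral_rpow_enorm_toReal hu0 hu', ← ENNReal.rpow_mul,
      one_div_mul_cancel hr.ne', ENNReal.rpow_one]
  simp_rw [hpow]
  -- After the swap, the inner integral over `θ` is that of a translate of `|cos|^u`, hence
  -- independent of the argument of `g t`.
  rw [lintegral_lintegral_swap]
  · rw [ENNReal.mul_rpow_of_nonneg _ _ hr.le, hpow, hpow, ← lintegral_const_mul']
    · refine lintegral_congr fun t => ?_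
      have h1 : ∀ θ, ‖oscillation g m γ θ t‖ₑ ^ u.toReal =
          ‖g t‖ₑ ^ u.toReal * ‖cos (θ + (m * t - γ + Complex.arg (g t)))‖ₑ ^ u.toReal := by
        intro θ
        rw [oscillation_eq_cos, enorm_mul, ENNReal.mul_rpow_of_nonneg _ _ hr.le]
        simp
      simp_rw [h1]
      rw [lintegral_const_mul', ← hpow, eLpNorm_add_shift continuous_cos periodic_cos_two_pi,
        hpow, mul_comm]
      exact ENNReal.rpow_ne_top_of_nonneg hr.le (by simp)
    · rw [← hpow]
      exact ENNReal.rpow_ne_top_of_nonneg hr.le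
        (memLp_of_continuous_periodic continuous_cos periodic_cos_two_pi u).2.ne
  · have := (continuous_oscillation hg m γ).measurable
    exact ((this.enorm).pow_const _).aemeasurable

/-- The `L_u`-norm of a rapidly oscillating function is close to the product of the mean of the
oscillation and of the norm of the amplitude. -/
theorem abs_normL_oscillation_sub_main_le {g : ℝ → ℂ} (hg : Continuous g)
    (hp : Function.Periodic g (2 * π)) {m : ℕ} (hm : 1 ≤ m) (γ : ℝ) {u : ℝ≥0∞} (hu : 1 ≤ u)
    {D : ℝ} (hD : ∀ τ ∈ Set.Icc 0 (2 * π / m),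
      (eLpNorm (fun t => g (t + τ) - g t) u periodMeasure).toReal ≤ D) :
    |normL u (oscillation g m γ 0) -
      (2 * π) ^ (-recip u) * normL u cos * (eLpNorm g u periodMeasure).toReal| ≤ D := by
  have key : ∀ θ ∈ Set.Icc 0 (2 * π),
      |normL u (oscillation g m γ 0) - normL u (oscillation g m γ θ)| ≤ D := fun θ hθ =>
    abs_normL_oscillation_sub_le hg hp hm γ hu hD hθ
  have hc : ∀ θ, Continuous (oscillation g m γ θ) := fun θ =>
    (continuous_oscillation hg m γ).comp (by fun_prop : Continuous fun t => (θ, t))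
  have hP := fun θ => periodic_oscillation hp m γ θ
  have hfin : ∀ θ, eLpNorm (oscillation g m γ θ) u periodMeasure ≠ ⊤ := fun θ =>
    (memLp_of_continuous_periodic (hc θ) (hP θ) u).2.ne
  have hfinc : eLpNorm cos u periodMeasure ≠ ⊤ :=
    (memLp_of_continuous_periodic continuous_cos periodic_cos_two_pi u).2.ne
  have hfing : eLpNorm g u periodMeasure ≠ ⊤ := (memLp_of_continuous_periodic hg hp u).2.ne
  rcases eq_or_ne u ∞ with rfl | hu'
  · have hcos : normL ∞ cos = 1 := by
      apply le_antisymm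
      · unfold normL
        rw [eLpNorm_exponent_top]
        refine ENNReal.toReal_le_of_le_ofReal zero_le_one
          (eLpNormEssSup_le_of_ae_bound (.of_forall fun t => abs_cos_le_one t))
      · have h := norm_le_of_continuous_periodic continuous_cos periodic_cos_two_pi 0
        rwa [cos_zero, norm_one] at h
    rw [hcos]
    simp only [recip, ENNReal.inv_top, ENNReal.toReal_zero, neg_zero, rpow_zero, one_mul]
    have hle : normL ∞ (oscillation g m γ 0) ≤ (eLpNorm g ∞ periodMeasure).toReal :=
      ENNReal.toReal_mono hfing (eLpNorm_mono fun t => by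
        simpa using abs_oscillation_le g m γ 0 t)
    rw [abs_sub_comm, abs_of_nonneg (sub_nonneg.2 hle), sub_le_comm]
    -- For `u = ∞` no averaging is needed: for each `t` some phase `θ` makes the cosine equal to `1`
    -- there.
    have hptw : ∀ t, ‖g t‖ ≤ normL ∞ (oscillation g m γ 0) + D := by
      intro t
      have hper : Function.Periodic (fun θ => cos (θ + (m * t - γ + Complex.arg (g t)))) (2 * π) :=
        periodic_cos_two_pi.add_const _
      obtain ⟨θ, hθ, h⟩ := hper.exists_mem_Ico₀ two_pi_pos (-(m * t - γ + Complex.arg (g t)))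
      simp only [neg_add_cancel, cos_zero] at h
      have h1 := norm_le_of_continuous_periodic (hc θ) (hP θ) t
      rw [oscillation_eq_cos, ← h, mul_one, norm_norm] at h1
      have h2 := (abs_le.1 (key θ ⟨hθ.1, hθ.2.le⟩)).1
      unfold normL at h2 ⊢
      linarith
    rw [sub_le_iff_le_add]
    have h0 : 0 ≤ normL ∞ (oscillation g m γ 0) + D := (norm_nonneg _).trans (hptw 0)
    rw [eLpNorm_exponent_top]
    exact ENNReal.toReal_le_of_le_ofReal h0 (eLpNormEssSup_le_of_ae_bound (.of_forall hptw))
  · have hu0 : u ≠ 0 := (zero_lt_one.trans_le hu).ne'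
    have hr : 0 < u.toReal := ENNReal.toReal_pos hu0 hu'
    -- For finite `u`, every phase has norm within `D` of the norm at phase `0`, so comparing the
    -- `θ`-average with constants traps the exact mean value.
    have hav := lintegral_oscillation hg m γ hu hu'
    have hP0 : ENNReal.ofReal (2 * π) ^ (1 / u.toReal) ≠ ⊤ :=
      ENNReal.rpow_ne_top_of_nonneg (by positivity) ENNReal.ofReal_ne_top
    have hconst : ∀ M : ℝ, ∫⁻ _θ, ENNReal.ofReal M ^ u.toReal ∂periodMeasure =
        (ENNReal.ofReal M * ENNReal.ofReal (2 * π) ^ (1 / u.toReal)) ^ u.toReal := by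
      intro M
      rw [lintegral_const, periodMeasure_univ, ENNReal.mul_rpow_of_nonneg _ _ hr.le,
        ← ENNReal.rpow_mul, one_div_mul_cancel hr.ne', ENNReal.rpow_one]
    have hmemae : ∀ᵐ θ ∂periodMeasure, θ ∈ Set.Icc 0 (2 * π) :=
      (ae_restrict_mem measurableSet_Ioc).mono fun θ hθ => ⟨hθ.1.le, hθ.2⟩
    have hrec : recip u = 1 / u.toReal := by simp [recip]
    have hpi : 0 < (2 * π) ^ (1 / u.toReal) := rpow_pos_of_pos two_pi_pos _
    have hpiE : (ENNReal.ofReal (2 * π) ^ (1 / u.toReal)).toReal = (2 * π) ^ (1 / u.toReal) := by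
      rw [← ENNReal.toReal_rpow, ENNReal.toReal_ofReal two_pi_pos.le]
    have hmain : (2 * π) ^ (-recip u) * normL u cos * (eLpNorm g u periodMeasure).toReal =
        (normL u cos * (eLpNorm g u periodMeasure).toReal) / (2 * π) ^ (1 / u.toReal) := by
      rw [rpow_neg two_pi_pos.le, hrec]; field_simp
    rw [hmain, abs_le]
    have hD0 : 0 ≤ D := (abs_nonneg _).trans (key 0 ⟨le_rfl, two_pi_pos.le⟩)
    have hn0 : ∀ θ, 0 ≤ normL u (oscillation g m γ θ) := fun θ => ENNReal.toReal_nonneg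
    constructor
    · have h1 : (eLpNorm cos u periodMeasure * eLpNorm g u periodMeasure) ^ u.toReal ≤
          (ENNReal.ofReal (normL u (oscillation g m γ 0) + D) *
            ENNReal.ofReal (2 * π) ^ (1 / u.toReal)) ^ u.toReal := by
        rw [← hav, ← hconst]
        refine lintegral_mono_ae (hmemae.mono fun θ hθ => ?_)
        refine ENNReal.rpow_le_rpow ?_ hr.le
        rw [← ENNReal.ofReal_toReal (hfin θ)]
        refine ENNReal.ofReal_le_ofReal ?_
        have := (abs_le.1 (key θ hθ)).1
        unfold normL at this ⊢
        linarith
      rw [ENNReal.rpow_le_rpow_iff hr] at h1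
      have h2 := ENNReal.toReal_mono (ENNReal.mul_ne_top ENNReal.ofReal_ne_top hP0) h1
      rw [ENNReal.toReal_mul, ENNReal.toReal_mul, hpiE,
        ENNReal.toReal_ofReal (add_nonneg (hn0 0) hD0), ← div_le_iff₀ hpi] at h2
      unfold normL at h2 ⊢
      linarith
    · have h1 : (ENNReal.ofReal (normL u (oscillation g m γ 0) - D) *
            ENNReal.ofReal (2 * π) ^ (1 / u.toReal)) ^ u.toReal ≤
          (eLpNorm cos u periodMeasure * eLpNorm g u periodMeasure) ^ u.toReal := by
        rw [← hav, ← hconst]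
        refine lintegral_mono_ae (hmemae.mono fun θ hθ => ?_)
        refine ENNReal.rpow_le_rpow ?_ hr.le
        rw [← ENNReal.ofReal_toReal (hfin θ)]
        refine ENNReal.ofReal_le_ofReal ?_
        have := (abs_le.1 (key θ hθ)).2
        unfold normL at this ⊢
        linarith
      rw [ENNReal.rpow_le_rpow_iff hr] at h1
      have h2 := ENNReal.toReal_mono (ENNReal.mul_ne_top hfinc hfing) h1
      rw [ENNReal.toReal_mul, ENNReal.toReal_mul, hpiE, ← le_div_iff₀ hpi] at h2
      -- `ENNReal.ofReal` truncates a negative difference to `0`, which is harmless in this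
      -- direction.
      have h3 : normL u (oscillation g m γ 0) - D ≤
          (ENNReal.ofReal (normL u (oscillation g m γ 0) - D)).toReal := by
        rw [ENNReal.toReal_ofReal']; exact le_max_left _ _
      unfold normL at h2 h3 ⊢
      linarith

/-! ### The amplitude on the circle of radius `q` and its power series. -/

/-- The point `q e^{it}`. -/
def circlePt (q t : ℝ) : ℂ := q * Complex.exp (t * Complex.I)

/-- The amplitude `(1 - z^p) / (1 - z)^2` at `z = q e^{it}`. -/
def amplitude (q : ℝ) (p : ℕ) (t : ℝ) : ℂ := (1 - circlePt q t ^ p) / (1 - circlePt q t) ^ 2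

lemma norm_circlePt {q : ℝ} (hq : 0 < q) (t : ℝ) : ‖circlePt q t‖ = q := by
  rw [circlePt, norm_mul, Complex.norm_exp_ofReal_mul_I, mul_one, Complex.norm_real,
    Real.norm_of_nonneg hq.le]

lemma one_sub_le_norm_one_sub_circlePt {q : ℝ} (hq : 0 < q) (t : ℝ) :
    1 - q ≤ ‖1 - circlePt q t‖ := by
  have := norm_sub_norm_le (1 : ℂ) (circlePt q t)
  rwa [norm_one, norm_circlePt hq] at this

lemma one_sub_circlePt_ne_zero {q : ℝ} (hq : 0 < q) (hq1 : q < 1) (t : ℝ) :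
    1 - circlePt q t ≠ 0 := by
  rw [← norm_pos_iff]
  linarith [one_sub_le_norm_one_sub_circlePt hq t]

lemma continuous_circlePt (q : ℝ) : Continuous (circlePt q) := by
  unfold circlePt; fun_prop

lemma periodic_circlePt (q : ℝ) : Function.Periodic (circlePt q) (2 * π) := by
  intro t
  have := exp_natCast_mul_periodic 1 0 t
  unfold circlePt
  simp only [Nat.cast_one, one_mul, add_zero] at this
  rw [this]

lemma continuous_amplitude {q : ℝ} (hq : 0 < q) (hq1 : q < 1) (p : ℕ) :
    Continuous (amplitude q p) :=
  (continuous_const.sub ((continuous_circlePt q).pow p)).div₀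
    ((continuous_const.sub (continuous_circlePt q)).pow 2)
    fun t => pow_ne_zero 2 (one_sub_circlePt_ne_zero hq hq1 t)

lemma periodic_amplitude (q : ℝ) (p : ℕ) : Function.Periodic (amplitude q p) (2 * π) := by
  intro t
  simp only [amplitude, periodic_circlePt q t]

lemma circlePt_pow (q t : ℝ) (k : ℕ) : circlePt q t ^ k = circlePt (q ^ k) (k * t) := by
  unfold circlePt
  rw [mul_pow, ← Complex.exp_nat_mul]
  push_cast
  ring_nf

lemma sq_norm_one_sub_circlePt (q t : ℝ) :
    ‖1 - circlePt q t‖ ^ 2 = 1 - 2 * q * cos t + q ^ 2 := by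
  rw [Complex.sq_norm, Complex.normSq_apply]
  have hre : (circlePt q t).re = q * cos t := by
    rw [circlePt, Complex.re_ofReal_mul, Complex.exp_ofReal_mul_I_re]
  have him : (circlePt q t).im = q * sin t := by
    rw [circlePt, Complex.im_ofReal_mul, Complex.exp_ofReal_mul_I_im]
  simp only [Complex.sub_re, Complex.one_re, Complex.sub_im, Complex.one_im, hre, him]
  have := sin_sq_add_cos_sq t
  linear_combination q ^ 2 * this

lemma norm_amplitude (q : ℝ) (p : ℕ) (t : ℝ) :
    ‖amplitude q p t‖ =
      √(1 - 2 * q ^ p * cos (p * t) + q ^ (2 * p)) / (1 - 2 * q * cos t + q ^ 2) := by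
  rw [amplitude, norm_div, norm_pow, sq_norm_one_sub_circlePt, circlePt_pow]
  congr 1
  rw [← Real.sqrt_sq (norm_nonneg _), sq_norm_one_sub_circlePt]
  congr 2
  rw [mul_comm 2 p, pow_mul]

lemma hasSum_shift_geometric {z : ℂ} (hz : ‖z‖ < 1) (p : ℕ) :
    HasSum (fun i : ℕ => if p ≤ i then z ^ i else 0) (z ^ p / (1 - z)) := by
  have h := (hasSum_geometric_of_norm_lt_one hz).mul_left (z ^ p)
  have hinj : Function.Injective (fun i : ℕ => i + p) := add_left_injective p
  rw [div_eq_mul_inv, ← hinj.hasSum_iff]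
  · convert! h using 1
    funext i
    simp [pow_add, mul_comm]
  · intro i hi
    rw [if_neg]
    intro hpi
    exact hi ⟨i - p, Nat.sub_add_cancel hpi⟩

/-- Passing from `p` to `p + 1` raises the coefficient by one exactly when `p ≤ i`, that is, adds
the geometric tail `z^p/(1-z)`. -/
lemma hasSum_min_mul_pow {z : ℂ} (hz : ‖z‖ < 1) (p : ℕ) :
    HasSum (fun i : ℕ => ((min (i + 1) p : ℕ) : ℂ) * z ^ i) ((1 - z ^ p) / (1 - z) ^ 2) := by
  have hz1 : 1 - z ≠ 0 := by
    intro h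
    rw [← sub_eq_zero.1 h, norm_one] at hz
    exact lt_irrefl _ hz
  induction p with
  | zero => simp
  | succ p ih =>
    convert! ih.add (hasSum_shift_geometric hz p) using 1
    · funext i
      split_ifs with h
      · rw [min_eq_right (by omega), min_eq_right (by omega)]; push_cast; ring
      · rw [min_eq_left (by omega), min_eq_left (by omega)]; push_cast; ring
    · field_simp; ring

/-! ### The deviation kernel and its leading oscillating part. -/

/-- The kernel (times `p`) of the deviation of the de la Vallée Poussin sums; `m = n - p + 1`. -/
def devKernel (q γ : ℝ) (m p : ℕ) (t : ℝ) : ℝ :=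
  ∑' i : ℕ, ((min (i + 1) p : ℕ) : ℝ) * neumann q (m + i) * cos ((m + i : ℕ) * t - γ)

lemma hasSum_mul_pow {q : ℝ} (hq : 0 < q) (hq1 : q < 1) :
    HasSum (fun i : ℕ => (i : ℝ) * q ^ i) (q / (1 - q) ^ 2) :=
  hasSum_coe_mul_geometric_of_norm_lt_one (by rwa [Real.norm_of_nonneg hq.le])

lemma hasSum_mul_succ_mul_pow {q : ℝ} (hq : 0 < q) (hq1 : q < 1) :
    HasSum (fun i : ℕ => ((i : ℝ) + 1) * i * q ^ i) (2 * q / (1 - q) ^ 3) := by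
  have h := (hasSum_choose_mul_geometric_of_norm_lt_one 2
    (show ‖q‖ < 1 by rwa [Real.norm_of_nonneg hq.le])).mul_left (2 * q)
  rw [← hasSum_nat_add_iff' 1]
  convert! h using 1
  · ext i
    have h2 : (((Nat.choose (i + 2) 2 : ℕ)) : ℝ) = (i + 2) * (i + 1) / 2 := by
      rw [Nat.cast_choose_two]; push_cast; ring
    rw [h2]; push_cast; ring
  · simp; ring

lemma neumann_nonneg {q : ℝ} (hq : 0 < q) (k : ℕ) : 0 ≤ neumann q k := by
  unfold neumann; positivity

lemma neumann_le_pow {q : ℝ} (hq : 0 < q) {k : ℕ} (hk : 1 ≤ k) : neumann q k ≤ q ^ k :=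
  div_le_self (by positivity) (by exact_mod_cast hk)

lemma summable_min_mul_neumann {q : ℝ} (hq : 0 < q) (hq1 : q < 1) {m : ℕ} (hm : 1 ≤ m) (p : ℕ) :
    Summable fun i : ℕ => ((min (i + 1) p : ℕ) : ℝ) * neumann q (m + i) := by
  have h := (summable_geometric_of_lt_one hq.le hq1).mul_left (p : ℝ)
  refine Summable.of_nonneg_of_le (fun i => mul_nonneg (by positivity) (neumann_nonneg hq _))
    (fun i => ?_) h
  refine mul_le_mul (by exact_mod_cast min_le_right _ _) ?_ (neumann_nonneg hq _) (by positivity)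
  refine (neumann_le_pow hq (by omega)).trans ?_
  exact pow_le_pow_of_le_one hq.le hq1.le (by omega)

lemma continuous_devKernel {q : ℝ} (hq : 0 < q) (hq1 : q < 1) (γ : ℝ) {m : ℕ} (hm : 1 ≤ m)
    (p : ℕ) : Continuous (devKernel q γ m p) := by
  unfold devKernel
  refine continuous_tsum (fun i => by fun_prop) (summable_min_mul_neumann hq hq1 hm p)
    fun i t => ?_
  rw [norm_mul, Real.norm_of_nonneg (mul_nonneg (by positivity) (neumann_nonneg hq _))]
  exact mul_le_of_le_one_right (mul_nonneg (by positivity) (neumann_nonneg hq _))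
    (abs_cos_le_one _)

lemma cos_natCast_mul_add_two_pi (k : ℕ) (t c : ℝ) :
    cos (k * (t + 2 * π) + c) = cos (k * t + c) := by
  rw [show (k : ℝ) * (t + 2 * π) + c = k * t + c + k * (2 * π) by ring]
  exact cos_add_nat_mul_two_pi _ _

lemma periodic_devKernel (q γ : ℝ) (m p : ℕ) :
    Function.Periodic (devKernel q γ m p) (2 * π) := by
  intro t
  unfold devKernel
  simp_rw [sub_eq_add_neg, cos_natCast_mul_add_two_pi]

lemma hasSum_oscillation_amplitude {q : ℝ} (hq : 0 < q) (hq1 : q < 1) (γ : ℝ) (m p : ℕ) (t : ℝ) :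
    HasSum (fun i : ℕ => ((min (i + 1) p : ℕ) : ℝ) * q ^ i * cos ((m + i : ℕ) * t - γ))
      (oscillation (amplitude q p) m γ 0 t) := by
  have hz : ‖circlePt q t‖ < 1 := by rwa [norm_circlePt hq]
  have h := Complex.hasSum_re ((hasSum_min_mul_pow hz p).mul_left
    (Complex.exp (((m * t - γ + 0 : ℝ) : ℂ) * Complex.I)))
  convert! h using 1
  funext i
  have h1 : Complex.exp (((m * t - γ + 0 : ℝ) : ℂ) * Complex.I) *
      (((min (i + 1) p : ℕ) : ℂ) * circlePt q t ^ i) =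
      (((min (i + 1) p : ℕ) * q ^ i : ℝ) : ℂ) *
        Complex.exp ((((m + i : ℕ) * t - γ : ℝ) : ℂ) * Complex.I) := by
    have h2 : Complex.exp ((((m + i : ℕ) * t - γ : ℝ) : ℂ) * Complex.I) =
      Complex.exp (((m * t - γ + 0 : ℝ) : ℂ) * Complex.I) *
        Complex.exp (((i * t : ℝ) : ℂ) * Complex.I) := by
      rw [← Complex.exp_add]
      congr 1
      push_cast; ring
    rw [h2, circlePt_pow, circlePt]
    simp only [Complex.ofReal_mul, Complex.ofReal_natCast]
    ring
  rw [h1, Complex.re_ofReal_mul, Complex.exp_ofReal_mul_I_re]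

/-- Termwise, `1/m - 1/(m+i) = i/(m(m+i)) ≤ i/(m(m+1))`. Bounding the weight `min(i+1, p)` by `p` or
by `i + 1` gives the two entries of the minimum; the factor `2` comes from `∑ (i+1) i q^i =
2q/(1-q)^3`. -/
lemma abs_devKernel_sub_le {q : ℝ} (hq : 0 < q) (hq1 : q < 1) (γ : ℝ) {m : ℕ} (hm : 1 ≤ m)
    {p : ℕ} (t : ℝ) :
    |devKernel q γ m p t - q ^ m / m * oscillation (amplitude q p) m γ 0 t| ≤
      q ^ m / m * (2 * (q / (((m + 1 : ℕ) : ℝ) * (1 - q) ^ 2) * min (p : ℝ) (1 / (1 - q)))) := by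
  have hm0 : (0 : ℝ) < m := by exact_mod_cast hm
  have h1q : 0 < 1 - q := by linarith
  have hN : HasSum (fun i : ℕ =>
      ((min (i + 1) p : ℕ) : ℝ) * neumann q (m + i) * cos ((m + i : ℕ) * t - γ))
      (devKernel q γ m p t) := by
    refine Summable.hasSum (Summable.of_norm_bounded (summable_min_mul_neumann hq hq1 hm p)
      fun i => ?_)
    rw [norm_mul, Real.norm_of_nonneg (mul_nonneg (by positivity) (neumann_nonneg hq _))]
    exact mul_le_of_le_one_right (mul_nonneg (by positivity) (neumann_nonneg hq _))
      (abs_cos_le_one _)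
  have hd := hN.sub ((hasSum_oscillation_amplitude hq hq1 γ m p t).mul_left (q ^ m / m))
  have hterm : ∀ i : ℕ, ‖((min (i + 1) p : ℕ) : ℝ) * neumann q (m + i) *
      cos ((m + i : ℕ) * t - γ) - q ^ m / m *
        (((min (i + 1) p : ℕ) : ℝ) * q ^ i * cos ((m + i : ℕ) * t - γ))‖ ≤
      q ^ m / m * (((min (i + 1) p : ℕ) : ℝ) * i * q ^ i / (m + 1)) := by
    intro i
    have h1 : ((min (i + 1) p : ℕ) : ℝ) * neumann q (m + i) *
      cos ((m + i : ℕ) * t - γ) - q ^ m / m *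
        (((min (i + 1) p : ℕ) : ℝ) * q ^ i * cos ((m + i : ℕ) * t - γ)) =
        -(q ^ m / m * (((min (i + 1) p : ℕ) : ℝ) * q ^ i * (i / (m + i)))
          * cos ((m + i : ℕ) * t - γ)) := by
      have : (m : ℝ) + i ≠ 0 := by positivity
      unfold neumann
      rw [pow_add]; push_cast
      field_simp
      ring
    have h2 : (i : ℝ) / (m + i) ≤ i / (m + 1) := by
      rcases Nat.eq_zero_or_pos i with rfl | hi
      · simp
      · have : (1 : ℝ) ≤ i := by exact_mod_cast hi
        gcongr
    rw [h1, norm_neg, norm_mul, Real.norm_of_nonneg (by positivity)]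
    refine (mul_le_of_le_one_right (by positivity) (abs_cos_le_one _)).trans ?_
    rw [mul_right_comm _ (i : ℝ), mul_div_assoc]
    gcongr
  have hb : ∀ {B : ℕ → ℝ} {S : ℝ}, HasSum B S → (∀ i, ((min (i + 1) p : ℕ) : ℝ) * i * q ^ i ≤ B i) →
      |devKernel q γ m p t - q ^ m / m * oscillation (amplitude q p) m γ 0 t| ≤
        q ^ m / m * (S / (m + 1)) := by
    intro B S hB hle
    rw [← hd.tsum_eq]
    refine tsum_of_norm_bounded ((hB.div_const _).mul_left _) fun i => (hterm i).trans ?_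
    have := hle i
    gcongr
  rcases min_choice (p : ℝ) (1 / (1 - q)) with h | h
  · rw [h]
    refine (hb ((hasSum_mul_pow hq hq1).mul_left (p : ℝ)) fun i => ?_).trans ?_
    · rw [mul_assoc]
      gcongr
      exact min_le_right _ _
    · gcongr
      have : 0 ≤ (p : ℝ) * q / ((m + 1) * (1 - q) ^ 2) := by positivity
      push_cast
      calc _ = (p : ℝ) * q / ((m + 1) * (1 - q) ^ 2) := by field_simp
        _ ≤ 2 * ((p : ℝ) * q / ((m + 1) * (1 - q) ^ 2)) := by linarith
        _ = _ := by field_simp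
  · rw [h]
    refine (hb (hasSum_mul_succ_mul_pow hq hq1) fun i => ?_).trans ?_
    · gcongr
      calc ((min (i + 1) p : ℕ) : ℝ) ≤ (i + 1 : ℕ) := by exact_mod_cast min_le_left _ _
        _ = _ := by push_cast; ring
    · apply le_of_eq
      push_cast
      field_simp

/-! ### The modulus of continuity of the amplitude and the exponent `σ`. -/

lemma norm_circlePt_sub_le {q : ℝ} (hq : 0 < q) (t τ : ℝ) (hτ : 0 ≤ τ) :
    ‖circlePt q (t + τ) - circlePt q t‖ ≤ q * τ := by
  have h : circlePt q (t + τ) - circlePt q t =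
      circlePt q t * (Complex.exp (Complex.I * τ) - 1) := by
    unfold circlePt
    push_cast
    rw [add_mul, Complex.exp_add, mul_comm (τ : ℂ)]
    ring
  rw [h, norm_mul, norm_circlePt hq]
  have := Real.norm_exp_I_mul_ofReal_sub_one_le (x := τ)
  rw [Real.norm_of_nonneg hτ] at this
  gcongr

lemma norm_pow_sub_pow_le {q : ℝ} {z w : ℂ} (hz : ‖z‖ ≤ q) (hw : ‖w‖ ≤ q) (i : ℕ) :
    ‖z ^ (i + 1) - w ^ (i + 1)‖ ≤ (i + 1) * q ^ i * ‖z - w‖ := by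
  have hq : 0 ≤ q := (norm_nonneg z).trans hz
  rw [← (Commute.all z w).geom_sum₂_mul (i + 1), norm_mul]
  gcongr
  refine (norm_sum_le _ _).trans ?_
  refine (Finset.sum_le_sum (g := fun _ => q ^ i) fun j hj => ?_).trans ?_
  · rw [norm_mul, norm_pow, norm_pow]
    have hj' : j ≤ i := by have := Finset.mem_range.1 hj; omega
    calc ‖z‖ ^ j * ‖w‖ ^ (i + 1 - 1 - j) ≤ q ^ j * q ^ (i + 1 - 1 - j) := by gcongr
      _ = q ^ i := by rw [← pow_add]; congr 1; omega
  · simp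

lemma norm_geom_sum_le {q : ℝ} (hq1 : q < 1) {z : ℂ} (hz : ‖z‖ ≤ q) (p : ℕ) :
    ‖∑ i ∈ Finset.range p, z ^ i‖ ≤ 1 / (1 - q) := by
  have hq : 0 ≤ q := (norm_nonneg z).trans hz
  refine (norm_sum_le _ _).trans ?_
  rw [one_div]
  refine (Finset.sum_le_sum fun i _ => ?_).trans
    (sum_le_hasSum (Finset.range p) (fun i _ => pow_nonneg hq i)
      (hasSum_geometric_of_lt_one hq hq1))
  rw [norm_pow]
  gcongr

lemma norm_geom_sum_sub_le {q : ℝ} (hq1 : q < 1) {z w : ℂ} (hz : ‖z‖ ≤ q)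
    (hw : ‖w‖ ≤ q) (p : ℕ) :
    ‖∑ i ∈ Finset.range p, z ^ i - ∑ i ∈ Finset.range p, w ^ i‖ ≤ 1 / (1 - q) ^ 2 * ‖z - w‖ := by
  have hq : 0 ≤ q := (norm_nonneg z).trans hz
  have hs : HasSum (fun i : ℕ => ((i : ℝ) + 1) * q ^ i) (1 / (1 - q) ^ 2) := by
    have := hasSum_choose_mul_geometric_of_norm_lt_one 1
      (show ‖q‖ < 1 by rwa [Real.norm_of_nonneg hq])
    simpa using this
  rw [← Finset.sum_sub_distrib]
  refine (norm_sum_le _ _).trans ?_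
  cases p with
  | zero =>
    simp only [Finset.range_zero, Finset.sum_empty]
    positivity
  | succ p =>
    rw [Finset.sum_range_succ']
    simp only [pow_zero, sub_self, norm_zero, add_zero]
    refine (Finset.sum_le_sum fun i _ => norm_pow_sub_pow_le hz hw i).trans ?_
    rw [← Finset.sum_mul]
    gcongr
    exact sum_le_hasSum _ (fun i _ => by positivity) hs

/-- Writing `(1-z^p)/(1-z)` as a finite geometric sum yields bounds uniform in `p`. -/
lemma amplitude_eq_geom_sum {q : ℝ} (hq : 0 < q) (hq1 : q < 1) (p : ℕ) (t : ℝ) :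
    amplitude q p t =
      (∑ i ∈ Finset.range p, circlePt q t ^ i) * (1 - circlePt q t)⁻¹ := by
  have h := one_sub_circlePt_ne_zero hq hq1 t
  have h2 := geom_sum_mul (circlePt q t) p
  unfold amplitude
  field_simp
  linear_combination h2

lemma amplitude_one {q : ℝ} (hq : 0 < q) (hq1 : q < 1) (t : ℝ) :
    amplitude q 1 t = (1 - circlePt q t)⁻¹ := by
  rw [amplitude_eq_geom_sum hq hq1]; simp

lemma norm_inv_one_sub_sub {q : ℝ} (hq : 0 < q) (hq1 : q < 1) (t s : ℝ) :
    ‖(1 - circlePt q t)⁻¹ - (1 - circlePt q s)⁻¹‖ =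
      ‖circlePt q t - circlePt q s‖ * (‖1 - circlePt q t‖⁻¹ * ‖1 - circlePt q s‖⁻¹) := by
  have h1 := one_sub_circlePt_ne_zero hq hq1 t
  have h2 := one_sub_circlePt_ne_zero hq hq1 s
  rw [← norm_inv, ← norm_inv, ← norm_mul, ← norm_mul]
  congr 1
  field_simp
  ring

lemma norm_inv_one_sub_le {q : ℝ} (hq : 0 < q) (hq1 : q < 1) (t : ℝ) :
    ‖1 - circlePt q t‖⁻¹ ≤ 1 / (1 - q) := by
  rw [← one_div]
  exact one_div_le_one_div_of_le (by linarith) (one_sub_le_norm_one_sub_circlePt hq t)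

lemma norm_inv_one_sub_sub_le {q : ℝ} (hq : 0 < q) (hq1 : q < 1) (t s : ℝ) :
    ‖(1 - circlePt q t)⁻¹ - (1 - circlePt q s)⁻¹‖ ≤
      1 / (1 - q) ^ 2 * ‖circlePt q t - circlePt q s‖ := by
  have h1q : 0 < 1 - q := by linarith
  rw [norm_inv_one_sub_sub hq hq1, mul_comm]
  gcongr
  calc _ ≤ 1 / (1 - q) * (1 / (1 - q)) := by
        gcongr <;> exact norm_inv_one_sub_le hq hq1 _
    _ = _ := by field_simp

/-- Product rule for geometric sum times `1/(1-z)`: each of the two terms contributes `(1-q)^{-3}`,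
whence the exponent `3` for `p ≥ 2`. -/
lemma norm_amplitude_sub_le {q : ℝ} (hq : 0 < q) (hq1 : q < 1) (p : ℕ) (t s : ℝ) :
    ‖amplitude q p t - amplitude q p s‖ ≤
      2 / (1 - q) ^ 3 * ‖circlePt q t - circlePt q s‖ := by
  have h1q : 0 < 1 - q := by linarith
  rw [amplitude_eq_geom_sum hq hq1, amplitude_eq_geom_sum hq hq1]
  have hsplit : ∀ a b c d : ℂ, a * b - c * d = (a - c) * b + c * (b - d) := by intros; ring
  rw [hsplit]
  refine (norm_add_le _ _).trans ?_
  rw [norm_mul, norm_mul, norm_inv]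
  calc _ ≤ 1 / (1 - q) ^ 2 * ‖circlePt q t - circlePt q s‖ * (1 / (1 - q)) +
        1 / (1 - q) * (1 / (1 - q) ^ 2 * ‖circlePt q t - circlePt q s‖) := by
        gcongr
        · exact norm_geom_sum_sub_le hq1 (norm_circlePt hq t).le (norm_circlePt hq s).le p
        · exact norm_inv_one_sub_le hq hq1 _
        · exact norm_geom_sum_le hq1 (norm_circlePt hq s).le p
        · exact norm_inv_one_sub_sub_le hq hq1 t s
    _ = _ := by field_simp; ring

/-- Up to the factor `1 - q^2` the integrand is the Poisson kernel at the point `q`, whose mean over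
the unit circle is `1`. -/
lemma integral_inv_sq_norm_one_sub {q : ℝ} (hq : 0 < q) (hq1 : q < 1) :
    ∫ t, (‖1 - circlePt q t‖⁻¹) ^ 2 ∂periodMeasure = 2 * π / (1 - q ^ 2) := by
  have h := DiffContOnCl.circleAverage_poissonKernel_smul (f := fun _ : ℂ => (1 : ℂ)) (R := 1)
    (c := 0) (w := (q : ℂ)) diffContOnCl_const
    (by simpa [abs_of_pos hq] using hq1)
  rw [Real.circleAverage_def, intervalIntegral_eq_periodMeasure] at h
  have hk : ∀ t : ℝ, (poissonKernel 0 (q : ℂ) • fun _ : ℂ => (1 : ℂ)) (circleMap 0 1 t) =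
      (((1 - q ^ 2) * (‖1 - circlePt q t‖⁻¹) ^ 2 : ℝ) : ℂ) := by
    intro t
    have hn : ‖circleMap 0 1 t - (q : ℂ)‖ = ‖1 - circlePt q t‖ := by
      -- The Poisson kernel involves `e^{it} - q`, which has the modulus of `1 - q e^{it}`.
      have h1 : circleMap 0 1 t - (q : ℂ) =
          Complex.exp (t * Complex.I) * (starRingEnd ℂ) (1 - circlePt q t) := by
        have : Complex.exp (t * Complex.I) * Complex.exp (-(t * Complex.I)) = 1 := by
          rw [← Complex.exp_add]; simp
        simp only [circleMap, circlePt, map_sub, map_one, map_mul, Complex.conj_ofReal,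
          ← Complex.exp_conj, Complex.conj_I]
        rw [mul_sub, mul_neg]
        push_cast
        linear_combination (q : ℂ) * this
      rw [h1, norm_mul, Complex.norm_exp_ofReal_mul_I, one_mul, RCLike.norm_conj]
    simp only [Pi.smul_apply', poissonKernel_def, sub_zero, hn]
    rw [norm_circleMap_zero]
    simp
    field_simp
  simp_rw [hk] at h
  rw [integral_complex_ofReal, integral_const_mul, ← Complex.coe_smul, smul_eq_mul] at h
  norm_cast at h
  have h2 : 1 - q ^ 2 ≠ 0 := by nlinarith
  rw [eq_div_iff h2]
  have hpi := two_pi_pos.ne'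
  rw [inv_mul_eq_div, div_eq_one_iff_eq hpi] at h
  linarith

lemma toReal_eLpNorm_one {E : Type*} [NormedAddCommGroup E] {f : ℝ → E}
    (hf : AEStronglyMeasurable f periodMeasure) :
    (eLpNorm f 1 periodMeasure).toReal = ∫ t, ‖f t‖ ∂periodMeasure := by
  rw [eLpNorm_one_eq_lintegral_enorm, integral_norm_eq_lintegral_enorm hf]

/-- The difference of the inverses is `|z-w|` over `|1-z||1-w|`. The inequality between arithmetic
and geometric means reduces this product to two Poisson integrals, which saves one power of `1 - q`
over the pointwise bound: this is `σ(1,1) = 1`. -/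
lemma normL_one_inv_sub_le {q : ℝ} (hq : 0 < q) (hq1 : q < 1) {τ : ℝ} (hτ : 0 ≤ τ) :
    (eLpNorm (fun t => amplitude q 1 (t + τ) - amplitude q 1 t) 1 periodMeasure).toReal ≤
      q * τ * (2 * π / (1 - q)) := by
  have hc : Continuous fun t => ‖1 - circlePt q t‖⁻¹ :=
    ((continuous_const.sub (continuous_circlePt q)).norm).inv₀ fun t =>
      (norm_pos_iff.2 (one_sub_circlePt_ne_zero hq hq1 t)).ne'
  have hper : Function.Periodic (fun t => (‖1 - circlePt q t‖⁻¹) ^ 2) (2 * π) := fun t => by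
    simp only [periodic_circlePt q t]
  have hamp := continuous_amplitude hq hq1 1
  have hmem : MemLp (fun t => amplitude q 1 (t + τ) - amplitude q 1 t) 1 periodMeasure :=
    memLp_of_continuous_periodic ((hamp.comp (by fun_prop)).sub hamp)
      (((periodic_amplitude q 1).add_const _).sub (periodic_amplitude q 1)) 1
  have hI1 : Integrable (fun t => (‖1 - circlePt q t‖⁻¹) ^ 2) periodMeasure :=
    memLp_one_iff_integrable.1 (memLp_of_continuous_periodic (hc.pow 2)
      hper 1)
  have hI2 : Integrable (fun t => (‖1 - circlePt q (t + τ)‖⁻¹) ^ 2) periodMeasure :=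
    memLp_one_iff_integrable.1 (memLp_of_continuous_periodic ((hc.pow 2).comp
      (by fun_prop : Continuous fun t => t + τ)) (hper.add_const τ) 1)
  have hI12 : ∫ t, (‖1 - circlePt q (t + τ)‖⁻¹) ^ 2 ∂periodMeasure =
      ∫ t, (‖1 - circlePt q t‖⁻¹) ^ 2 ∂periodMeasure := by
    rw [← intervalIntegral_eq_periodMeasure, ← intervalIntegral_eq_periodMeasure]
    rw [intervalIntegral.integral_comp_add_right (fun t => (‖1 - circlePt q t‖⁻¹) ^ 2) τ,
      zero_add, add_comm (2 * π) τ]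
    simpa using hper.intervalIntegral_add_eq τ 0
  rw [toReal_eLpNorm_one hmem.1]
  calc ∫ t, ‖amplitude q 1 (t + τ) - amplitude q 1 t‖ ∂periodMeasure
      ≤ ∫ t, q * τ / 2 * ((‖1 - circlePt q (t + τ)‖⁻¹) ^ 2 + (‖1 - circlePt q t‖⁻¹) ^ 2)
          ∂periodMeasure := by
        refine integral_mono (memLp_one_iff_integrable.1 hmem).norm
          ((hI2.add hI1).const_mul _) fun t => ?_
        simp only [amplitude_one hq hq1, norm_inv_one_sub_sub hq hq1]
        rw [div_mul_eq_mul_div, mul_div_assoc]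
        refine mul_le_mul (norm_circlePt_sub_le hq t τ hτ) ?_ (by positivity) (by positivity)
        have := two_mul_le_add_sq (‖1 - circlePt q (t + τ)‖⁻¹) (‖1 - circlePt q t‖⁻¹)
        linarith
    _ = q * τ * (2 * π / (1 - q ^ 2)) := by
        rw [integral_const_mul, integral_add hI2 hI1, hI12, integral_inv_sq_norm_one_sub hq hq1]
        ring
    _ ≤ q * τ * (2 * π / (1 - q)) := by
        have : 0 < 1 - q := by linarith
        have : q ^ 2 ≤ q := by nlinarith
        gcongr

lemma eLpNorm_amplitude_sub_le {q : ℝ} (hq : 0 < q) (hq1 : q < 1) {m p : ℕ} (hm : 1 ≤ m)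
    (hp : 1 ≤ p) {u : ℝ≥0∞} (hu : 1 ≤ u) {τ : ℝ} (hτ : τ ∈ Set.Icc 0 (2 * π / m)) :
    (eLpNorm (fun t => amplitude q p (t + τ) - amplitude q p t) u periodMeasure).toReal ≤
      8 * π ^ 2 * (q / (m * (1 - q) ^ sigmaExp u p)) := by
  have h1q : 0 < 1 - q := by linarith
  have hm0 : (0 : ℝ) < m := by exact_mod_cast hm
  have hpi := pi_pos
  -- The constant is `2π` (norm against supremum) times `2` (bound for `C`) times `2π` (from `τ ≤
  -- 2π/m`).
  have hsup : ∀ {C : ℝ} {k : ℕ}, 0 ≤ C → C ≤ 2 → (∀ t s, ‖amplitude q p t - amplitude q p s‖ ≤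
      C / (1 - q) ^ k * ‖circlePt q t - circlePt q s‖) →
      (eLpNorm (fun t => amplitude q p (t + τ) - amplitude q p t) u periodMeasure).toReal ≤
      8 * π ^ 2 * (q / (m * (1 - q) ^ k)) := by
    intro C k hC hC2 h
    have h1 : ∀ t, ‖amplitude q p (t + τ) - amplitude q p t‖ ≤
        2 / (1 - q) ^ k * (q * (2 * π / m)) := by
      intro t
      refine (h _ _).trans ?_
      gcongr
      exact (norm_circlePt_sub_le hq t τ hτ.1).trans (by gcongr; exact hτ.2)
    refine (toReal_eLpNorm_le_of_bound hu (by positivity) h1).trans (le_of_eq ?_)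
    field_simp
    norm_num
  unfold sigmaExp
  split_ifs with h1 h2
  · subst h1 h2
    refine (normL_one_inv_sub_le hq hq1 hτ.1).trans ?_
    have hτ2 := hτ.2
    calc q * τ * (2 * π / (1 - q)) ≤ q * (2 * π / m) * (2 * π / (1 - q)) := by gcongr
      _ = 4 * (π ^ 2 * (q / (m * (1 - q) ^ 1))) := by field_simp; norm_num
      _ ≤ 8 * (π ^ 2 * (q / (m * (1 - q) ^ 1))) := by gcongr; norm_num
      _ = _ := by ring
  · subst h1
    refine hsup zero_le_one one_le_two fun t s => ?_
    rw [amplitude_one hq hq1, amplitude_one hq hq1]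
    exact norm_inv_one_sub_sub_le hq hq1 t s
  · exact hsup zero_le_two le_rfl (norm_amplitude_sub_le hq hq1 p)

/-! ### The exact computation for `u = 2`. -/

lemma sq_toReal_eLpNorm_two {E : Type*} [NormedAddCommGroup E] {f : ℝ → E}
    (hf : Continuous f) (hp : Function.Periodic f (2 * π)) :
    (eLpNorm f 2 periodMeasure).toReal ^ 2 = ∫ t, ‖f t‖ ^ 2 ∂periodMeasure := by
  rw [MemLp.eLpNorm_eq_integral_rpow_norm (by simp) (by simp) (memLp_of_continuous_periodic hf hp 2)]
  have h0 : 0 ≤ ∫ t, ‖f t‖ ^ 2 ∂periodMeasure := integral_nonneg fun t => by positivity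
  simp only [ENNReal.toReal_ofNat, rpow_ofNat]
  rw [ENNReal.toReal_ofReal (by positivity), ← Real.rpow_natCast, ← Real.rpow_mul h0]
  simp

/-- In the variable `w = e^{it}` the integrand is a constant times `w^{2m}` times a function
analytic on the closed disc. Dividing by `w` for `dt` still leaves the nonnegative power `2m - 1`,
because `m ≥ 1`, and Cauchy's theorem applies. -/
lemma integral_sq_amplitude_eq_zero {q : ℝ} (hq : 0 < q) (hq1 : q < 1) {m : ℕ} (hm : 1 ≤ m)
    (p : ℕ) (γ : ℝ) :
    ∫ t, (Complex.exp (((m * t - γ + 0 : ℝ) : ℂ) * Complex.I) * amplitude q p t) ^ 2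
      ∂periodMeasure = 0 := by
  have hne : ∀ z ∈ Metric.closedBall (0 : ℂ) 1, 1 - q * z ≠ 0 := by
    intro z hz h
    rw [Metric.mem_closedBall, dist_zero_right] at hz
    have h1 : ‖(q : ℂ) * z‖ = 1 := by rw [← sub_eq_zero.1 h, norm_one]
    rw [norm_mul, Complex.norm_real, Real.norm_of_nonneg hq.le] at h1
    nlinarith [norm_nonneg z]
  have hd : ∀ z ∈ Metric.closedBall (0 : ℂ) 1, DifferentiableAt ℂ
      (fun z : ℂ => z ^ (2 * m - 1) * ((1 - (q * z) ^ p) / (1 - q * z) ^ 2) ^ 2) z := by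
    intro z hz
    have := pow_ne_zero 2 (hne z hz)
    fun_prop (disch := assumption)
  have h := Complex.circleIntegral_eq_zero_of_differentiable_on_off_countable zero_le_one
    Set.countable_empty (fun z hz => (hd z hz).continuousAt.continuousWithinAt)
    (fun z hz => hd z (Metric.ball_subset_closedBall hz.1))
  rw [circleIntegral, intervalIntegral_eq_periodMeasure] at h
  have hpt : ∀ t : ℝ,
      (Complex.exp (((m * t - γ + 0 : ℝ) : ℂ) * Complex.I) * amplitude q p t) ^ 2 =
      (Complex.exp (-2 * γ * Complex.I) * -Complex.I) * (deriv (circleMap 0 1) t •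
        (circleMap 0 1 t ^ (2 * m - 1) *
          ((1 - (q * circleMap 0 1 t) ^ p) / (1 - q * circleMap 0 1 t) ^ 2) ^ 2)) := by
    intro t
    rw [deriv_circleMap]
    have hc : circleMap 0 1 t = Complex.exp (t * Complex.I) := by simp [circleMap]
    have hA : (1 - (q * circleMap 0 1 t) ^ p) / (1 - q * circleMap 0 1 t) ^ 2 =
        amplitude q p t := by rw [hc]; rfl
    rw [hA, mul_pow, ← Complex.exp_nat_mul, smul_eq_mul]
    have h2 : circleMap 0 1 t * circleMap 0 1 t ^ (2 * m - 1) =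
        Complex.exp ((2 * m : ℕ) * (t * Complex.I)) := by
      rw [← pow_succ', hc, ← Complex.exp_nat_mul]
      congr 3
      omega
    have h3 : Complex.exp ((2 : ℕ) * (((m * t - γ + 0 : ℝ) : ℂ) * Complex.I)) =
        Complex.exp (-2 * γ * Complex.I) * Complex.exp ((2 * m : ℕ) * (t * Complex.I)) := by
      rw [← Complex.exp_add]
      congr 1
      push_cast; ring
    rw [h3, ← h2]
    linear_combination (Complex.exp (-2 * γ * Complex.I) * (circleMap 0 1 t *
      circleMap 0 1 t ^ (2 * m - 1)) * amplitude q p t ^ 2) * Complex.I_sq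
  simp_rw [hpt]
  rw [integral_const_mul, h, mul_zero]

/-- Since `(Re W)^2 = |W|^2/2 + Re(W^2)/2` and the last term integrates to zero, the asymptotic
formula is an identity; hence `δ(2) = 0`. -/
lemma normL_two_oscillation_amplitude {q : ℝ} (hq : 0 < q) (hq1 : q < 1) {m : ℕ} (hm : 1 ≤ m)
    (p : ℕ) (γ : ℝ) :
    normL 2 (oscillation (amplitude q p) m γ 0) =
      (2 * π) ^ (-recip 2) * normL 2 cos * (eLpNorm (amplitude q p) 2 periodMeasure).toReal := by
  have hg := continuous_amplitude hq hq1 p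
  have hp := periodic_amplitude q p
  have hc : Continuous (oscillation (amplitude q p) m γ 0) :=
    (continuous_oscillation hg m γ).comp (by fun_prop : Continuous fun t => ((0 : ℝ), t))
  have hP := periodic_oscillation hp m γ 0
  have h1 : normL 2 (oscillation (amplitude q p) m γ 0) ^ 2 =
      1 / 2 * (eLpNorm (amplitude q p) 2 periodMeasure).toReal ^ 2 := by
    unfold normL
    rw [sq_toReal_eLpNorm_two hc hP, sq_toReal_eLpNorm_two hg hp]
    set w : ℝ → ℂ := fun t =>
      (Complex.exp (((m * t - γ + 0 : ℝ) : ℂ) * Complex.I) * amplitude q p t) ^ 2 with hw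
    have hwc : Continuous w := by rw [hw]; fun_prop
    have hwp : Function.Periodic w (2 * π) := by
      intro t
      have h := exp_natCast_mul_periodic m (-γ) t
      simp only [hw, hp t, add_zero, sub_eq_add_neg]
      rw [h]
    have hpt : ∀ t, ‖oscillation (amplitude q p) m γ 0 t‖ ^ 2 =
        1 / 2 * ‖amplitude q p t‖ ^ 2 + 1 / 2 * (w t).re := by
      intro t
      have hn : ‖amplitude q p t‖ =
          ‖Complex.exp (((m * t - γ + 0 : ℝ) : ℂ) * Complex.I) * amplitude q p t‖ := by
        rw [norm_mul, Complex.norm_exp_ofReal_mul_I, one_mul]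
      rw [hn, Complex.sq_norm, Complex.normSq_apply, hw, oscillation, Real.norm_eq_abs, sq_abs]
      simp only [sq, Complex.mul_re]
      ring
    have hint : Integrable w periodMeasure :=
      memLp_one_iff_integrable.1 (memLp_of_continuous_periodic hwc hwp 1)
    have hint2 : Integrable (fun t => ‖amplitude q p t‖ ^ 2) periodMeasure :=
      memLp_one_iff_integrable.1 (memLp_of_continuous_periodic (hg.norm.pow 2)
        (fun t => by show ‖_‖ ^ 2 = ‖_‖ ^ 2; rw [hp t]) 1)
    simp_rw [hpt]
    have hint3 : Integrable (fun t => (w t).re) periodMeasure := hint.re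
    rw [integral_add (hint2.const_mul _) (hint3.const_mul _), integral_const_mul,
      integral_const_mul]
    have hre : ∫ t, (w t).re ∂periodMeasure = (∫ t, w t ∂periodMeasure).re := integral_re hint
    rw [hre, hw, integral_sq_amplitude_eq_zero hq hq1 hm p γ]
    simp
  have h2 : normL 2 cos ^ 2 = π := by
    unfold normL
    rw [sq_toReal_eLpNorm_two continuous_cos periodic_cos_two_pi,
      ← intervalIntegral_eq_periodMeasure]
    simp only [Real.norm_eq_abs, sq_abs]
    rw [integral_cos_sq]
    simp
  have h3 : ((2 * π) ^ (-recip 2)) ^ 2 = 1 / (2 * π) := by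
    rw [← Real.rpow_natCast, ← Real.rpow_mul two_pi_pos.le]
    simp [recip, Real.rpow_neg_one]
  have hpi := pi_pos
  refine (pow_left_inj₀ ENNReal.toReal_nonneg ?_ two_ne_zero).1 ?_
  · exact mul_nonneg (mul_nonneg (by positivity) ENNReal.toReal_nonneg) ENNReal.toReal_nonneg
  · change normL 2 _ ^ 2 = _
    rw [h1, mul_pow, mul_pow, h2, h3]
    field_simp

/-! ### Assembling the norm of the kernel. -/

/-- The norm of the kernel of the deviation. -/
theorem abs_normL_devKernel_sub_le {q : ℝ} (hq : 0 < q) (hq1 : q < 1) {m p : ℕ} (hm : 1 ≤ m)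
    (hp : 1 ≤ p) (γ : ℝ) {s : ℝ≥0∞} (hs : 1 ≤ s) :
    |1 / π * normL (ENNReal.conjExponent s) (devKernel q γ m p) -
      q ^ m / m * mainConst q p (ENNReal.conjExponent s)| ≤
      q ^ m / m * (32 * (q * deltaS s / ((m : ℝ) * (1 - q) ^ sigmaExp (ENNReal.conjExponent s) p) +
        q / (((m + 1 : ℕ) : ℝ) * (1 - q) ^ 2) * min (p : ℝ) (1 / (1 - q)))) := by
  set u := ENNReal.conjExponent s with hu_def
  have hconj : s.HolderConjugate u := .conjExponent hs
  have hu : 1 ≤ u := ENNReal.HolderConjugate.one_le u s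
  have h1q : 0 < 1 - q := by linarith
  have hm0 : (0 : ℝ) < m := by exact_mod_cast hm
  have hpi := pi_pos
  have hg := continuous_amplitude hq hq1 p
  have hP := periodic_amplitude q p
  have hc : Continuous (oscillation (amplitude q p) m γ 0) :=
    (continuous_oscillation hg m γ).comp (by fun_prop : Continuous fun t => ((0 : ℝ), t))
  have hoP := periodic_oscillation hP m γ 0
  set X := q / (((m + 1 : ℕ) : ℝ) * (1 - q) ^ 2) * min (p : ℝ) (1 / (1 - q)) with hX
  have hX0 : 0 ≤ X := by positivity
  set Y := q / ((m : ℝ) * (1 - q) ^ sigmaExp u p) with hY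
  have hY0 : 0 ≤ Y := by positivity
  have hYd : q * deltaS s / ((m : ℝ) * (1 - q) ^ sigmaExp u p) = deltaS s * Y := by
    rw [hY]; ring
  rw [hYd]
  -- The factor `2^{-1/u}` of `Kqp` and `π^{-1-1/u}` recombine into `(1/π)(2π)^{-1/u}`.
  have hmain : mainConst q p u = 1 / π * ((2 * π) ^ (-recip u) * normL u cos *
      (eLpNorm (amplitude q p) u periodMeasure).toReal) := by
    have hK : normL u (fun t => √(1 - 2 * q ^ p * cos (p * t) + q ^ (2 * p)) /
        (1 - 2 * q * cos t + q ^ 2)) = (eLpNorm (amplitude q p) u periodMeasure).toReal := by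
      simp_rw [← norm_amplitude]
      rw [normL, eLpNorm_norm]
    rw [mainConst, Kqp, hK, mul_rpow two_pos.le hpi.le, rpow_add hpi, rpow_one, rpow_neg hpi.le]
    field_simp
  have hstep1 : |normL u (devKernel q γ m p) -
      q ^ m / m * normL u (oscillation (amplitude q p) m γ 0)| ≤
      q ^ m / m * (4 * π * X) := by
    have hsm : q ^ m / m * normL u (oscillation (amplitude q p) m γ 0) =
        normL u (fun t => q ^ m / m * oscillation (amplitude q p) m γ 0 t) := by
      unfold normL
      have : (fun t => q ^ m / m * oscillation (amplitude q p) m γ 0 t) =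
        (q ^ m / m) • oscillation (amplitude q p) m γ 0 := rfl
      rw [this, eLpNorm_const_smul, ENNReal.toReal_mul]
      congr 1
      rw [toReal_enorm, Real.norm_of_nonneg (by positivity)]
    rw [hsm]
    have hcN := continuous_devKernel hq hq1 γ hm p
    have hPN := periodic_devKernel q γ m p
    refine (abs_toReal_eLpNorm_sub_le hu (memLp_of_continuous_periodic hcN hPN u)
      ((memLp_of_continuous_periodic hc hoP u).const_mul _)).trans ?_
    refine (toReal_eLpNorm_le_of_bound hu (by positivity)
      (fun t => abs_devKernel_sub_le hq hq1 γ hm t)).trans (le_of_eq ?_)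
    ring
  have hstep2 : |normL u (oscillation (amplitude q p) m γ 0) - (2 * π) ^ (-recip u) * normL u cos *
      (eLpNorm (amplitude q p) u periodMeasure).toReal| ≤ 8 * π ^ 2 * (deltaS s * Y) := by
    unfold deltaS
    split_ifs with hs2
    · have hu2 : u = 2 := by
        rw [hu_def, hs2, ENNReal.conjExponent]
        rw [show (2 : ℝ≥0∞) - 1 = 1 by
          rw [← one_add_one_eq_two]; exact ENNReal.add_sub_cancel_left ENNReal.one_ne_top]
        norm_num
      rw [hu2, normL_two_oscillation_amplitude hq hq1 hm, sub_self]
      simp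
    · rw [one_mul]
      exact abs_normL_oscillation_sub_main_le hg hP hm γ hu
        fun τ hτ => eLpNorm_amplitude_sub_le hq hq1 hm hp hu hτ
  have hδ : 0 ≤ deltaS s * Y := mul_nonneg (by unfold deltaS; split_ifs <;> norm_num) hY0
  have hc0 : 0 < q ^ m / m := by positivity
  rw [hmain]
  set M := (2 * π) ^ (-recip u) * normL u cos *
      (eLpNorm (amplitude q p) u periodMeasure).toReal
  set O := normL u (oscillation (amplitude q p) m γ 0)
  set Nn := normL u (devKernel q γ m p)
  have hsum : 1 / π * Nn - q ^ m / m * (1 / π * M) =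
      1 / π * ((Nn - q ^ m / m * O) + q ^ m / m * (O - M)) := by ring
  rw [hsum, abs_mul, abs_of_pos (by positivity : 0 < 1 / π)]
  calc 1 / π * |Nn - q ^ m / m * O + q ^ m / m * (O - M)|
      ≤ 1 / π * (q ^ m / m * (4 * π * X) + q ^ m / m * (8 * π ^ 2 * (deltaS s * Y))) := by
        gcongr
        refine (abs_add_le _ _).trans (add_le_add hstep1 ?_)
        rw [abs_mul, abs_of_pos hc0]
        gcongr
    _ = q ^ m / m * (4 * X + 8 * π * (deltaS s * Y)) := by field_simp
    -- The constant `32` dominates `8π`, as `π ≤ 4`.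
    _ ≤ q ^ m / m * (32 * (deltaS s * Y + X)) := by
        gcongr
        nlinarith [pi_le_four]

/-! ### Fourier coefficients, orthogonality and uniqueness. -/

lemma integrable_of_memL_one {φ : ℝ → ℝ} (h : MemL 1 φ) : Integrable φ periodMeasure :=
  memLp_one_iff_integrable.1 h.2

lemma fourierA_eq (f : ℝ → ℝ) (k : ℕ) :
    fourierA f k = 1 / π * ∫ t, f t * cos (k * t) ∂periodMeasure := by
  rw [fourierA, intervalIntegral_eq_periodMeasure]

lemma fourierB_eq (f : ℝ → ℝ) (k : ℕ) :
    fourierB f k = 1 / π * ∫ t, f t * sin (k * t) ∂periodMeasure := by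
  rw [fourierB, intervalIntegral_eq_periodMeasure]

lemma integral_cos_int_mul_add {n : ℤ} (hn : n ≠ 0) (c : ℝ) :
    ∫ t, cos (n * t + c) ∂periodMeasure = 0 := by
  have hn' : (n : ℝ) ≠ 0 := by exact_mod_cast hn
  rw [← intervalIntegral_eq_periodMeasure, intervalIntegral.integral_comp_mul_add _ hn',
    integral_cos, add_comm _ c, sin_add_int_mul_two_pi]
  simp

lemma integrable_of_continuous_periodic {E : Type*} [NormedAddCommGroup E] {f : ℝ → E}
    (hf : Continuous f) (hp : Function.Periodic f (2 * π)) : Integrable f periodMeasure :=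
  memLp_one_iff_integrable.1 (memLp_of_continuous_periodic hf hp 1)

lemma integrable_cos_int_mul_add (n : ℤ) (c : ℝ) :
    Integrable (fun t => cos (n * t + c)) periodMeasure := by
  refine integrable_of_continuous_periodic (by fun_prop) fun t => ?_
  rw [show (n : ℝ) * (t + 2 * π) + c = n * t + c + n * (2 * π) by ring]
  exact cos_add_int_mul_two_pi _ _

lemma integral_cos_mul_cos {j k : ℕ} (hk : 1 ≤ k) (c d : ℝ) :
    ∫ t, cos (j * t + c) * cos (k * t + d) ∂periodMeasure =
      if j = k then π * cos (c - d) else 0 := by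
  have h : ∀ t : ℝ, cos (j * t + c) * cos (k * t + d) =
      1 / 2 * cos (((j - k : ℤ) : ℝ) * t + (c - d)) +
        1 / 2 * cos (((j + k : ℤ) : ℝ) * t + (c + d)) := by
    intro t
    have h1 : ((j - k : ℤ) : ℝ) * t + (c - d) = (j * t + c) - (k * t + d) := by push_cast; ring
    have h2 : ((j + k : ℤ) : ℝ) * t + (c + d) = (j * t + c) + (k * t + d) := by push_cast; ring
    rw [h1, h2, cos_sub (j * t + c), cos_add (j * t + c) (k * t + d)]; ring
  simp_rw [h]
  rw [integral_add ((integrable_cos_int_mul_add _ _).const_mul _)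
    ((integrable_cos_int_mul_add _ _).const_mul _), integral_const_mul, integral_const_mul,
    integral_cos_int_mul_add (n := (j + k : ℤ)) (by omega)]
  split_ifs with hjk
  · subst hjk
    simp only [sub_self, Int.cast_zero, zero_mul, zero_add, integral_const, smul_eq_mul, measureReal_def]
    rw [periodMeasure_univ, ENNReal.toReal_ofReal two_pi_pos.le]
    ring
  · rw [integral_cos_int_mul_add (n := (j - k : ℤ)) (by omega)]
    simp

lemma integrable_mul_of_continuous_periodic {φ g : ℝ → ℝ} (hφ : Integrable φ periodMeasure)
    (hg : Continuous g) (hp : Function.Periodic g (2 * π)) :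
    Integrable (fun t => φ t * g t) periodMeasure := by
  obtain ⟨C, -, hC⟩ := exists_bound_of_continuous_periodic hg hp
  exact hφ.mul_bdd (c := C) hg.aestronglyMeasurable (.of_forall hC)

lemma periodic_cos_natCast_mul_add (k : ℕ) (c : ℝ) :
    Function.Periodic (fun t => cos (k * t + c)) (2 * π) := fun t =>
  cos_natCast_mul_add_two_pi k t c

lemma integrable_mul_cos {φ : ℝ → ℝ} (hφ : Integrable φ periodMeasure) (k : ℕ) (c : ℝ) :
    Integrable (fun t => φ t * cos (k * t + c)) periodMeasure :=
  integrable_mul_of_continuous_periodic hφ (by fun_prop) (periodic_cos_natCast_mul_add k c)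

/-- The Fourier coefficient of `f` against `cos (k t + c)`. -/
def fourierPhase (f : ℝ → ℝ) (k : ℕ) (c : ℝ) : ℝ :=
  1 / π * ∫ t, f t * cos (k * t + c) ∂periodMeasure

lemma fourierA_eq_phase (f : ℝ → ℝ) (k : ℕ) : fourierA f k = fourierPhase f k 0 := by
  rw [fourierA_eq, fourierPhase]; simp

lemma fourierB_eq_phase (f : ℝ → ℝ) (k : ℕ) : fourierB f k = fourierPhase f k (-(π / 2)) := by
  rw [fourierB_eq, fourierPhase]
  simp_rw [← sub_eq_add_neg, cos_sub_pi_div_two]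

lemma fourierPhase_eq {φ : ℝ → ℝ} (hφ : Integrable φ periodMeasure) (k : ℕ) (c : ℝ) :
    fourierPhase φ k c = fourierA φ k * cos c - fourierB φ k * sin c := by
  rw [fourierA_eq_phase, fourierB_eq_phase]
  unfold fourierPhase
  have h : ∀ t, φ t * cos (k * t + c) =
      φ t * cos (k * t + 0) * cos c - φ t * cos (k * t + -(π / 2)) * sin c := by
    intro t
    rw [← sub_eq_add_neg, cos_sub_pi_div_two, cos_add, add_zero]; ring
  simp_rw [h]
  rw [integral_sub ((integrable_mul_cos hφ k _).mul_const _)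
    ((integrable_mul_cos hφ k _).mul_const _), integral_mul_const, integral_mul_const]
  ring

/-- A continuous periodic function all of whose Fourier coefficients vanish is zero. -/
theorem eq_zero_of_fourier_eq_zero {h : ℝ → ℝ} (hc : MemC h) (hA : ∀ k, fourierA h k = 0)
    (hB : ∀ k, fourierB h k = 0) (x : ℝ) : h x = 0 := by
  have hlift : Continuous (hc.1.lift : AddCircle (2 * π) → ℝ) :=
    continuous_coinduced_dom.mpr hc.2
  let F : C(AddCircle (2 * π), ℂ) := ⟨fun y => (hc.1.lift y : ℂ), by fun_prop⟩
  have hF : ∀ t : ℝ, F (t : AddCircle (2 * π)) = (h t : ℂ) := fun t => by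
    show ((hc.1.lift (t : AddCircle (2 * π)) : ℝ) : ℂ) = _
    rw [hc.1.lift_coe]
  have hint := integrable_of_continuous_periodic hc.2 hc.1
  have hphase : ∀ (k : ℕ) (c : ℝ), ∫ t, h t * cos (k * t + c) ∂periodMeasure = 0 := by
    intro k c
    have h1 := fourierPhase_eq hint k c
    rw [hA, hB, fourierPhase] at h1
    simpa [pi_ne_zero] using h1
  have hphaseZ : ∀ (n : ℤ) (c : ℝ), ∫ t, h t * cos (n * t + c) ∂periodMeasure = 0 := by
    intro n c
    obtain ⟨k, rfl | rfl⟩ := n.eq_nat_or_neg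
    · exact_mod_cast hphase k c
    · have := hphase k (-c)
      rw [← this]
      refine integral_congr_ae (.of_forall fun t => ?_)
      simp only
      rw [← cos_neg]
      congr 2
      push_cast; ring
  have hcoef : ∀ n : ℤ, fourierCoeff F n = 0 := by
    intro n
    rw [fourierCoeff_eq_intervalIntegral _ _ 0, zero_add, intervalIntegral_eq_periodMeasure]
    have h1 : ∀ t : ℝ, (fourier (-n)) (t : AddCircle (2 * π)) • F (t : AddCircle (2 * π)) =
        ((h t * cos (n * t + 0) : ℝ) : ℂ) +
          ((h t * cos (n * t + π / 2) : ℝ) : ℂ) * Complex.I := by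
      intro t
      have h2 : (fourier (-n)) (t : AddCircle (2 * π)) =
          Complex.exp (((-(n * t) : ℝ) : ℂ) * Complex.I) := by
        rw [fourier_coe_apply]
        congr 1
        have := Complex.ofReal_ne_zero.2 pi_ne_zero
        push_cast
        field_simp
      rw [h2, Complex.exp_mul_I, hF, smul_eq_mul, cos_add_pi_div_two, add_zero,
        ← Complex.ofReal_cos, ← Complex.ofReal_sin, cos_neg, sin_neg]
      push_cast
      ring
    simp_rw [h1]
    have hi : ∀ c : ℝ, Integrable (fun t => ((h t * cos (n * t + c) : ℝ) : ℂ)) periodMeasure := by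
      intro c
      refine (integrable_of_continuous_periodic (hc.2.mul (by fun_prop)) fun t => ?_).ofReal
      show h (t + 2 * π) * cos _ = h t * cos _
      rw [hc.1 t, show (n : ℝ) * (t + 2 * π) + c = n * t + c + n * (2 * π) by ring,
        cos_add_int_mul_two_pi]
    rw [integral_add (hi 0) ((hi (π / 2)).mul_const _), integral_mul_const, integral_complex_ofReal,
      integral_complex_ofReal, hphaseZ, hphaseZ]
    simp
  -- Vanishing coefficients are summable, so the Fourier series converges pointwise to the
  -- continuous function, and its sum is zero.
  have hs : Summable (fourierCoeff F) := by
    simp_rw [show fourierCoeff F = fun _ => 0 from funext hcoef]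
    exact summable_zero
  have h2 := has_pointwise_sum_fourier_series_of_summable hs (x : AddCircle (2 * π))
  simp_rw [hcoef, zero_smul] at h2
  have h3 := h2.unique hasSum_zero
  rw [hF] at h3
  exact_mod_cast h3

/-! ### The `(ψ, β)`-integral, inverse to the `(ψ, β)`-derivative. -/

/-- The `k`-th term of the series of the `(ψ, β)`-integral of `φ`. -/
def psiTerm (q γ : ℝ) (φ : ℝ → ℝ) (k : ℕ) (x : ℝ) : ℝ :=
  neumann q k * (fourierA φ k * cos (k * x + -γ) + fourierB φ k * cos (k * x + (-γ - π / 2)))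

/-- The `(ψ, β)`-integral of `φ`, where `γ = βπ/2`. -/
def psiIntegral (q γ : ℝ) (φ : ℝ → ℝ) (x : ℝ) : ℝ := ∑' k, psiTerm q γ φ k x

/-- Division by zero gives `0` here, so series over all `k` silently start at `k = 1`. -/
lemma neumann_zero (q : ℝ) : neumann q 0 = 0 := by simp [neumann]

lemma abs_fourierPhase_le {φ : ℝ → ℝ} (hφ : Integrable φ periodMeasure) (k : ℕ) (c : ℝ) :
    |fourierPhase φ k c| ≤ 1 / π * ∫ t, |φ t| ∂periodMeasure := by
  rw [fourierPhase, abs_mul, abs_of_pos (by positivity)]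
  gcongr
  refine (abs_integral_le_integral_abs).trans ?_
  refine integral_mono (integrable_mul_cos hφ k c).abs hφ.abs fun t => ?_
  simp only [abs_mul]
  exact mul_le_of_le_one_right (abs_nonneg _) (abs_cos_le_one _)

lemma exists_psiTerm_bound {q : ℝ} (hq : 0 < q) (hq1 : q < 1) (γ : ℝ) {φ : ℝ → ℝ}
    (hφ : Integrable φ periodMeasure) :
    ∃ B : ℕ → ℝ, Summable B ∧ ∀ k x, ‖psiTerm q γ φ k x‖ ≤ B k := by
  set C := 1 / π * ∫ t, |φ t| ∂periodMeasure with hC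
  have hC0 : 0 ≤ C := by positivity
  refine ⟨fun k => q ^ k * (C + C), (summable_geometric_of_lt_one hq.le hq1).mul_right _,
    fun k x => ?_⟩
  have hA := abs_fourierPhase_le hφ k 0
  have hB := abs_fourierPhase_le hφ k (-(π / 2))
  rw [← fourierA_eq_phase] at hA
  rw [← fourierB_eq_phase] at hB
  have hn : neumann q k ≤ q ^ k := by
    rcases Nat.eq_zero_or_pos k with rfl | hk
    · rw [neumann_zero]; positivity
    · exact neumann_le_pow hq hk
  rw [psiTerm, norm_mul, Real.norm_of_nonneg (neumann_nonneg hq k)]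
  refine mul_le_mul hn ?_ (norm_nonneg _) (by positivity)
  refine (norm_add_le _ _).trans (add_le_add ?_ ?_)
  · rw [norm_mul]
    exact (mul_le_of_le_one_right (norm_nonneg _) (abs_cos_le_one _)).trans hA
  · rw [norm_mul]
    exact (mul_le_of_le_one_right (norm_nonneg _) (abs_cos_le_one _)).trans hB

lemma continuous_psiTerm (q γ : ℝ) (φ : ℝ → ℝ) (k : ℕ) : Continuous (psiTerm q γ φ k) := by
  unfold psiTerm; fun_prop

lemma periodic_psiTerm (q γ : ℝ) (φ : ℝ → ℝ) (k : ℕ) :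
    Function.Periodic (psiTerm q γ φ k) (2 * π) := by
  intro t
  simp only [psiTerm, cos_natCast_mul_add_two_pi]

lemma memC_psiIntegral {q : ℝ} (hq : 0 < q) (hq1 : q < 1) (γ : ℝ) {φ : ℝ → ℝ}
    (hφ : Integrable φ periodMeasure) : MemC (psiIntegral q γ φ) := by
  obtain ⟨B, hB, hle⟩ := exists_psiTerm_bound hq hq1 γ hφ
  refine ⟨fun t => ?_, continuous_tsum (continuous_psiTerm q γ φ) hB hle⟩
  unfold psiIntegral
  simp_rw [periodic_psiTerm q γ φ _ t]

lemma hasSum_psiTerm {q : ℝ} (hq : 0 < q) (hq1 : q < 1) (γ : ℝ) {φ : ℝ → ℝ}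
    (hφ : Integrable φ periodMeasure) (x : ℝ) :
    HasSum (fun k => psiTerm q γ φ k x) (psiIntegral q γ φ x) := by
  obtain ⟨B, hB, hle⟩ := exists_psiTerm_bound hq hq1 γ hφ
  exact (Summable.of_norm_bounded hB fun k => hle k x).hasSum

lemma hasSum_integral_psiIntegral_mul {q : ℝ} (hq : 0 < q) (hq1 : q < 1) (γ : ℝ) {φ : ℝ → ℝ}
    (hφ : Integrable φ periodMeasure) {g : ℝ → ℝ} (hg : Continuous g)
    (hp : Function.Periodic g (2 * π)) :
    HasSum (fun k => ∫ t, psiTerm q γ φ k t * g t ∂periodMeasure)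
      (∫ t, psiIntegral q γ φ t * g t ∂periodMeasure) := by
  obtain ⟨B, hB, hle⟩ := exists_psiTerm_bound hq hq1 γ hφ
  obtain ⟨C, hC0, hC⟩ := exists_bound_of_continuous_periodic hg hp
  have hi : ∀ k, Integrable (fun t => psiTerm q γ φ k t * g t) periodMeasure := fun k =>
    integrable_mul_of_continuous_periodic
      (integrable_of_continuous_periodic (continuous_psiTerm q γ φ k) (periodic_psiTerm q γ φ k))
      hg hp
  have h := hasSum_integral_of_summable_integral_norm hi ?_
  · convert! h using 1
    refine integral_congr_ae (.of_forall fun t => ?_)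
    exact ((hasSum_psiTerm hq hq1 γ hφ t).mul_right (g t)).tsum_eq.symm
  · refine Summable.of_nonneg_of_le (fun k => integral_nonneg fun t => norm_nonneg _)
      (fun k => ?_) (hB.mul_right (C * (2 * π)))
    calc ∫ t, ‖psiTerm q γ φ k t * g t‖ ∂periodMeasure ≤ ∫ _t, B k * C ∂periodMeasure := by
          refine integral_mono (hi k).norm (integrable_const _) fun t => ?_
          simp only [norm_mul]
          exact mul_le_mul (hle k t) (hC t) (norm_nonneg _) ((norm_nonneg _).trans (hle k t))
      _ = B k * (C * (2 * π)) := by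
          rw [integral_const, measureReal_def, periodMeasure_univ,
            ENNReal.toReal_ofReal two_pi_pos.le, smul_eq_mul]
          ring

lemma fourierPhase_psiIntegral {q : ℝ} (hq : 0 < q) (hq1 : q < 1) (γ : ℝ) {φ : ℝ → ℝ}
    (hφ : Integrable φ periodMeasure) {k : ℕ} (hk : 1 ≤ k) (d : ℝ) :
    fourierPhase (psiIntegral q γ φ) k d =
      neumann q k * (fourierA φ k * cos (γ + d) - fourierB φ k * sin (γ + d)) := by
  have h := hasSum_integral_psiIntegral_mul hq hq1 γ hφ (g := fun t => cos (k * t + d))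
    (by fun_prop) (periodic_cos_natCast_mul_add k d)
  have hterm : ∀ j : ℕ, ∫ t, psiTerm q γ φ j t * cos (k * t + d) ∂periodMeasure =
      if j = k then π * (neumann q k *
        (fourierA φ k * cos (γ + d) - fourierB φ k * sin (γ + d))) else 0 := by
    intro j
    have h1 : ∀ t, psiTerm q γ φ j t * cos (k * t + d) =
        neumann q j * fourierA φ j * (cos (j * t + -γ) * cos (k * t + d)) +
        neumann q j * fourierB φ j * (cos (j * t + (-γ - π / 2)) * cos (k * t + d)) := by
      intro t; unfold psiTerm; ring
    have hi : ∀ c, Integrable (fun t => cos (j * t + c) * cos (k * t + d)) periodMeasure :=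
      fun c => integrable_mul_cos (integrable_of_continuous_periodic (by fun_prop)
        (periodic_cos_natCast_mul_add j c)) k d
    simp_rw [h1]
    rw [integral_add ((hi _).const_mul _) ((hi _).const_mul _), integral_const_mul,
      integral_const_mul, integral_cos_mul_cos hk, integral_cos_mul_cos hk]
    split_ifs with hjk
    · subst hjk
      rw [show -γ - d = -(γ + d) by ring, show -γ - π / 2 - d = -((γ + d) + π / 2) by ring,
        cos_neg, cos_neg, cos_add_pi_div_two]
      ring
    · simp
  simp_rw [hterm] at h
  have h2 := h.unique (hasSum_ite_eq k _)
  rw [fourierPhase, h2]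
  field_simp

lemma fourierA_zero_psiIntegral {q : ℝ} (hq : 0 < q) (hq1 : q < 1) (γ : ℝ) {φ : ℝ → ℝ}
    (hφ : Integrable φ periodMeasure) : fourierA (psiIntegral q γ φ) 0 = 0 := by
  have h := hasSum_integral_psiIntegral_mul hq hq1 γ hφ (g := fun t => cos ((0 : ℕ) * t))
    (by fun_prop) (fun t => by simp)
  have hterm : ∀ j : ℕ, ∫ t, psiTerm q γ φ j t * cos ((0 : ℕ) * t) ∂periodMeasure = 0 := by
    intro j
    rcases Nat.eq_zero_or_pos j with rfl | hj
    · simp [psiTerm, neumann_zero]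
    · have hi : ∀ c, Integrable (fun t => cos (j * t + c)) periodMeasure := fun c =>
        integrable_of_continuous_periodic (by fun_prop) (periodic_cos_natCast_mul_add j c)
      have h0 : ∀ c, ∫ t, cos (j * t + c) ∂periodMeasure = 0 := fun c => by
        exact_mod_cast integral_cos_int_mul_add (n := (j : ℤ)) (by omega) c
      simp only [psiTerm, Nat.cast_zero, zero_mul, cos_zero, mul_one]
      rw [integral_const_mul, integral_add ((hi _).const_mul _) ((hi _).const_mul _),
        integral_const_mul, integral_const_mul, h0, h0]
      simp
  simp_rw [hterm] at h
  rw [fourierA_eq, h.unique hasSum_zero, mul_zero]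

lemma fourierA_psiIntegral {q : ℝ} (hq : 0 < q) (hq1 : q < 1) (γ : ℝ) {φ : ℝ → ℝ}
    (hφ : Integrable φ periodMeasure) {k : ℕ} (hk : 1 ≤ k) :
    fourierA (psiIntegral q γ φ) k =
      neumann q k * (fourierA φ k * cos γ - fourierB φ k * sin γ) := by
  rw [fourierA_eq_phase, fourierPhase_psiIntegral hq hq1 γ hφ hk, add_zero]

lemma fourierB_psiIntegral {q : ℝ} (hq : 0 < q) (hq1 : q < 1) (γ : ℝ) {φ : ℝ → ℝ}
    (hφ : Integrable φ periodMeasure) {k : ℕ} (hk : 1 ≤ k) :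
    fourierB (psiIntegral q γ φ) k =
      neumann q k * (fourierA φ k * sin γ + fourierB φ k * cos γ) := by
  rw [fourierB_eq_phase, fourierPhase_psiIntegral hq hq1 γ hφ hk, ← sub_eq_add_neg,
    cos_sub_pi_div_two, sin_sub_pi_div_two]
  ring

lemma neumann_pos {q : ℝ} (hq : 0 < q) {k : ℕ} (hk : 1 ≤ k) : 0 < neumann q k :=
  div_pos (pow_pos hq k) (by exact_mod_cast hk)

/-- On each harmonic, integration rotates the pair of coefficients by `γ` and differentiation
rotates it back. This produces members of the class from any mean-zero `φ` in `L_s`. -/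
theorem memCPsi_psiIntegral {q : ℝ} (hq : 0 < q) (hq1 : q < 1) (β : ℝ) {s : ℝ≥0∞} (hs : 1 ≤ s)
    {φ : ℝ → ℝ} (hφ : MemL s φ) (h0 : fourierA φ 0 = 0) :
    MemCPsi (neumann q) β s (psiIntegral q (β * π / 2) φ) φ := by
  have h1 : MemL 1 φ := ⟨hφ.1, hφ.2.mono_exponent hs⟩
  have hint := integrable_of_memL_one h1
  refine ⟨memC_psiIntegral hq hq1 _ hint, ⟨h1, h0, fun k hk x => ?_⟩, hφ⟩
  have hne := (neumann_pos hq hk).ne'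
  rw [fourierA_psiIntegral hq hq1 _ hint hk, fourierB_psiIntegral hq hq1 _ hint hk, cos_add,
    sin_add]
  field_simp
  have := sin_sq_add_cos_sq (β * π / 2)
  linear_combination (-(fourierA φ k * cos (k * x) + fourierB φ k * sin (k * x))) * this

lemma fourier_eq_of_isPsiDeriv {q : ℝ} (hq : 0 < q) {β : ℝ} {f φ : ℝ → ℝ}
    (h : IsPsiDeriv (neumann q) β f φ) {k : ℕ} (hk : 1 ≤ k) :
    fourierA f k = neumann q k *
      (fourierA φ k * cos (β * π / 2) - fourierB φ k * sin (β * π / 2)) ∧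
    fourierB f k = neumann q k *
      (fourierA φ k * sin (β * π / 2) + fourierB φ k * cos (β * π / 2)) := by
  have hne := (neumann_pos hq hk).ne'
  have hk0 : (k : ℝ) ≠ 0 := by positivity
  -- The points `0` and `π/(2k)` isolate the two coefficients of `φ`; the resulting linear system is
  -- a rotation, inverted by `sin² + cos² = 1`.
  have e1 := h.2.2 k hk 0
  have e2 := h.2.2 k hk (π / 2 / k)
  rw [mul_div_cancel₀ _ hk0] at e2
  rw [add_comm (π / 2), cos_add_pi_div_two, sin_add_pi_div_two] at e2
  simp only [mul_zero, cos_zero, sin_zero, mul_one, add_zero, zero_add, cos_pi_div_two,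
    sin_pi_div_two] at e1 e2
  rw [e1, e2]
  have := sin_sq_add_cos_sq (β * π / 2)
  constructor
  · field_simp
    linear_combination (-fourierA f k) * this
  · field_simp
    linear_combination (-fourierB f k) * this

lemma fourierPhase_sub {f g : ℝ → ℝ} (hf : Integrable f periodMeasure)
    (hg : Integrable g periodMeasure) (k : ℕ) (c : ℝ) :
    fourierPhase (fun t => f t - g t) k c = fourierPhase f k c - fourierPhase g k c := by
  unfold fourierPhase
  simp_rw [sub_mul]
  rw [integral_sub (integrable_mul_cos hf k c) (integrable_mul_cos hg k c)]
  ring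

lemma fourierPhase_const {k : ℕ} (hk : 1 ≤ k) (a c : ℝ) : fourierPhase (fun _ => a) k c = 0 := by
  have h := integral_cos_int_mul_add (n := (k : ℤ)) (by omega) c
  rw [Int.cast_natCast] at h
  rw [fourierPhase, integral_const_mul, h]
  simp

lemma fourierA_const (a : ℝ) : fourierA (fun _ => a) 0 = 2 * a := by
  rw [fourierA_eq]
  simp only [Nat.cast_zero, zero_mul, cos_zero, mul_one, integral_const, measureReal_def,
    periodMeasure_univ, smul_eq_mul]
  rw [ENNReal.toReal_ofReal two_pi_pos.le]
  field_simp

/-- Both sides are continuous with the same Fourier coefficients, so they agree at every point and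
not only almost everywhere. -/
theorem eq_add_psiIntegral {q : ℝ} (hq : 0 < q) (hq1 : q < 1) {β : ℝ} {f φ : ℝ → ℝ}
    (hf : MemC f) (h : IsPsiDeriv (neumann q) β f φ) (x : ℝ) :
    f x = fourierA f 0 / 2 + psiIntegral q (β * π / 2) φ x := by
  have hint := integrable_of_memL_one h.1
  have hP := memC_psiIntegral hq hq1 (β * π / 2) hint
  have hfi := integrable_of_continuous_periodic hf.2 hf.1
  have hPi := integrable_of_continuous_periodic hP.2 hP.1
  have hd : MemC fun t => f t - psiIntegral q (β * π / 2) φ t :=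
    ⟨hf.1.sub hP.1, hf.2.sub hP.2⟩
  have hdi := integrable_of_continuous_periodic hd.2 hd.1
  have hci : Integrable (fun _ : ℝ => fourierA f 0 / 2) periodMeasure := integrable_const _
  have hC : MemC fun t => f t - psiIntegral q (β * π / 2) φ t - fourierA f 0 / 2 :=
    ⟨fun t => by simp only [hf.1 t, hP.1 t], hd.2.sub continuous_const⟩
  have key := eq_zero_of_fourier_eq_zero hC
    (fun k => ?_) (fun k => ?_) x
  · linarith
  · rw [fourierA_eq_phase, fourierPhase_sub hdi hci, fourierPhase_sub hfi hPi,
      ← fourierA_eq_phase, ← fourierA_eq_phase, ← fourierA_eq_phase]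
    rcases Nat.eq_zero_or_pos k with rfl | hk
    · rw [fourierA_zero_psiIntegral hq hq1 _ hint, fourierA_const]; ring
    · rw [fourierA_psiIntegral hq hq1 _ hint hk, (fourier_eq_of_isPsiDeriv hq h hk).1,
        fourierA_eq_phase (fun _ => fourierA f 0 / 2), fourierPhase_const hk]
      ring
  · rcases Nat.eq_zero_or_pos k with rfl | hk
    · simp [fourierB]
    · rw [fourierB_eq_phase, fourierPhase_sub hdi hci, fourierPhase_sub hfi hPi,
        ← fourierB_eq_phase, ← fourierB_eq_phase, fourierB_psiIntegral hq hq1 _ hint hk,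
        (fourier_eq_of_isPsiDeriv hq h hk).2, fourierPhase_const hk]
      ring

/-! ### The integral representation of the deviation. -/

lemma psiTerm_eq_phase {φ : ℝ → ℝ} (hφ : Integrable φ periodMeasure) (q γ : ℝ) (k : ℕ) (x : ℝ) :
    psiTerm q γ φ k x = neumann q k * fourierPhase φ k (γ - k * x) := by
  rw [fourierPhase_eq hφ, psiTerm, show γ - k * x = -(k * x + -γ) by ring, cos_neg, sin_neg,
    show k * x + (-γ - π / 2) = k * x + -γ - π / 2 by ring, cos_sub_pi_div_two]
  ring

lemma hasSum_ite_shift {T : ℕ → ℝ} {S : ℝ} (hT : HasSum T S) (m p : ℕ) :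
    HasSum (fun i : ℕ => if p ≤ i then T (m + i) else 0)
      (S - ∑ j ∈ Finset.range (m + p), T j) := by
  have h := (hasSum_nat_add_iff' (m + p)).2 hT
  have hinj : Function.Injective (fun i : ℕ => i + p) := add_left_injective p
  rw [← hinj.hasSum_iff]
  · convert! h using 1
    funext i
    simp only [Function.comp_apply, le_add_iff_nonneg_left, zero_le, if_true]
    congr 1; omega
  · intro i hi
    rw [if_neg]
    intro hpi
    exact hi ⟨i - p, Nat.sub_add_cancel hpi⟩

/-- The term `m + i` belongs to the `r`-th tail exactly when `r ≤ i`, hence to `min(i+1, p)` of the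
`p` tails. -/
lemma hasSum_min_mul_tail {T : ℕ → ℝ} {S : ℝ} (hT : HasSum T S) (m p : ℕ) :
    HasSum (fun i : ℕ => ((min (i + 1) p : ℕ) : ℝ) * T (m + i))
      (∑ r ∈ Finset.range p, (S - ∑ j ∈ Finset.range (m + r), T j)) := by
  induction p with
  | zero => simp
  | succ p ih =>
    rw [Finset.sum_range_succ]
    convert! ih.add (hasSum_ite_shift hT m p) using 1
    funext i
    split_ifs with h
    · rw [min_eq_right (by omega), min_eq_right (by omega)]; push_cast; ring
    · rw [min_eq_left (by omega), min_eq_left (by omega)]; push_cast; ring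

lemma hasSum_integral_mul_devKernel {q : ℝ} (hq : 0 < q) (hq1 : q < 1) (γ : ℝ) {m : ℕ}
    (hm : 1 ≤ m) (p : ℕ) {φ : ℝ → ℝ} (hφ : Integrable φ periodMeasure) (x : ℝ) :
    HasSum (fun i : ℕ => ((min (i + 1) p : ℕ) : ℝ) *
      (neumann q (m + i) * fourierPhase φ (m + i) (γ - (m + i : ℕ) * x)))
      (1 / π * ∫ t, φ t * devKernel q γ m p (x - t) ∂periodMeasure) := by
  set F : ℕ → ℝ → ℝ := fun i t => φ t * (((min (i + 1) p : ℕ) : ℝ) * neumann q (m + i) *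
    cos ((m + i : ℕ) * (x - t) - γ)) with hF
  have hFeq : ∀ i t, F i t = ((min (i + 1) p : ℕ) : ℝ) * neumann q (m + i) *
      (φ t * cos ((m + i : ℕ) * t + (γ - (m + i : ℕ) * x))) := by
    intro i t
    simp only [hF]
    rw [← cos_neg, show -(((m + i : ℕ) : ℝ) * (x - t) - γ) =
      (m + i : ℕ) * t + (γ - (m + i : ℕ) * x) by ring]
    ring
  have hw0 : ∀ i, 0 ≤ ((min (i + 1) p : ℕ) : ℝ) * neumann q (m + i) := fun i =>
    mul_nonneg (by positivity) (neumann_nonneg hq _)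
  have hi : ∀ i, Integrable (F i) periodMeasure := by
    intro i
    rw [show F i = fun t => _ from funext (hFeq i)]
    exact (integrable_mul_cos hφ _ _).const_mul _
  have hsum := summable_min_mul_neumann hq hq1 hm p
  have h := (hasSum_integral_of_summable_integral_norm hi ?_).mul_left (1 / π)
  · convert! h using 1
    · funext i
      simp_rw [hFeq]
      rw [integral_const_mul, fourierPhase]
      ring
    · congr 1
      refine integral_congr_ae (.of_forall fun t => ?_)
      simp only [hF, devKernel]
      rw [tsum_mul_left]
  · refine Summable.of_nonneg_of_le (fun k => integral_nonneg fun t => norm_nonneg _)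
      (fun i => ?_) (hsum.mul_right (∫ t, |φ t| ∂periodMeasure))
    rw [← integral_const_mul]
    refine integral_mono (hi i).norm (hφ.abs.const_mul _) fun t => ?_
    simp only [hF]
    rw [norm_mul, norm_mul, Real.norm_of_nonneg (hw0 i), mul_comm, Real.norm_eq_abs,
      Real.norm_eq_abs]
    exact mul_le_mul_of_nonneg_right (mul_le_of_le_one_right (hw0 i) (abs_cos_le_one _))
      (abs_nonneg _)

lemma partialSum_eq {q : ℝ} (hq : 0 < q) {β : ℝ} {f φ : ℝ → ℝ}
    (h : IsPsiDeriv (neumann q) β f φ) (k : ℕ) (x : ℝ) :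
    partialSum k f x = fourierA f 0 / 2 +
      ∑ j ∈ Finset.range (k + 1), psiTerm q (β * π / 2) φ j x := by
  have h0 : psiTerm q (β * π / 2) φ 0 x = 0 := by simp [psiTerm, neumann_zero]
  rw [partialSum, Finset.range_eq_Ico, Finset.sum_eq_sum_Ico_succ_bot (Nat.succ_pos k), h0,
    zero_add, zero_add]
  congr 1
  refine Finset.sum_congr rfl fun j hj => ?_
  obtain ⟨hA, hB⟩ := fourier_eq_of_isPsiDeriv hq h (Finset.mem_Icc.1 hj).1
  rw [hA, hB, psiTerm, show j * x + (-(β * π / 2) - π / 2) = j * x + -(β * π / 2) - π / 2 by ring,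
    cos_sub_pi_div_two, cos_add, sin_add, cos_neg, sin_neg]
  ring

/-- Integral representation of the deviation. -/
theorem deviation_eq_integral {q : ℝ} (hq : 0 < q) (hq1 : q < 1) {β : ℝ} {f φ : ℝ → ℝ}
    (hf : MemC f) (h : IsPsiDeriv (neumann q) β f φ) {n p : ℕ} (hp : 1 ≤ p) (hpn : p ≤ n)
    (x : ℝ) :
    deviation n p f x = 1 / p * (1 / π *
      ∫ t, φ t * devKernel q (β * π / 2) (n - p + 1) p (x - t) ∂periodMeasure) := by
  have hint := integrable_of_memL_one h.1
  have hp0 : (p : ℝ) ≠ 0 := by positivity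
  have h1 := hasSum_integral_mul_devKernel hq hq1 (β * π / 2) (Nat.le_add_left 1 (n - p)) p hint x
  have h2 := hasSum_min_mul_tail (hasSum_psiTerm hq hq1 (β * π / 2) hint x) (n - p + 1) p
  simp_rw [psiTerm_eq_phase hint q (β * π / 2) (n - p + 1 + _)] at h2
  rw [h1.unique h2, deviation, vpSum, eq_add_psiIntegral hq hq1 hf h x]
  rw [Finset.sum_Ico_eq_sum_range, show n - (n - p) = p by omega]
  simp_rw [partialSum_eq hq h]
  rw [Finset.sum_add_distrib, Finset.sum_sub_distrib]
  simp only [Finset.sum_const, Finset.card_range, nsmul_eq_mul]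
  -- The partial sum of order `n - p + r` uses the indices below `n - p + r + 1 = m + r`, the cut of
  -- the `r`-th tail.
  have h3 : ∀ r, n - p + r + 1 = n - p + 1 + r := fun r => by omega
  simp_rw [h3]
  field_simp
  ring

/-! ### Best approximation and the upper bound through Hölder's inequality. -/

lemma continuous_trigPoly (m : ℕ) (a b : ℕ → ℝ) : Continuous (trigPoly m a b) := by
  unfold trigPoly; fun_prop

lemma periodic_trigPoly (m : ℕ) (a b : ℕ → ℝ) : Function.Periodic (trigPoly m a b) (2 * π) := by
  intro t
  unfold trigPoly
  refine Finset.sum_congr rfl fun k _ => ?_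
  have h1 := cos_natCast_mul_add_two_pi k t 0
  have h2 := cos_natCast_mul_add_two_pi k t (-(π / 2))
  rw [← sub_eq_add_neg, ← sub_eq_add_neg, cos_sub_pi_div_two, cos_sub_pi_div_two] at h2
  rw [add_zero, add_zero] at h1
  rw [h1, h2]

lemma fourierPhase_trigPoly {m k : ℕ} (hm : 1 ≤ m) (hk : m ≤ k) (a b : ℕ → ℝ) (c : ℝ) :
    fourierPhase (trigPoly m a b) k c = 0 := by
  unfold fourierPhase trigPoly
  have h : ∀ t, (∑ j ∈ Finset.range m, (a j * cos (j * t) + b j * sin (j * t))) *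
      cos (k * t + c) = ∑ j ∈ Finset.range m, (a j * (cos (j * t + 0) * cos (k * t + c)) +
        b j * (cos (j * t + -(π / 2)) * cos (k * t + c))) := by
    intro t
    rw [Finset.sum_mul]
    refine Finset.sum_congr rfl fun j _ => ?_
    rw [← sub_eq_add_neg, cos_sub_pi_div_two, add_zero]
    ring
  have hi : ∀ (j : ℕ) (d : ℝ), Integrable (fun t => cos (j * t + d) * cos (k * t + c))
      periodMeasure := fun j d => integrable_mul_cos (integrable_of_continuous_periodic
        (by fun_prop) (periodic_cos_natCast_mul_add j d)) k c
  simp_rw [h]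
  have hi2 : ∀ j ∈ Finset.range m, Integrable (fun t => a j * (cos (j * t + 0) * cos (k * t + c)) +
      b j * (cos (j * t + -(π / 2)) * cos (k * t + c))) periodMeasure := fun j _ =>
    ((hi j 0).const_mul _).add ((hi j _).const_mul _)
  rw [integral_finsetSum _ hi2]
  rw [Finset.sum_eq_zero, mul_zero]
  intro j hj
  have hjk : j ≠ k := by have := Finset.mem_range.1 hj; omega
  rw [integral_add ((hi j 0).const_mul _) ((hi j _).const_mul _), integral_const_mul,
    integral_const_mul, integral_cos_mul_cos (hm.trans hk), integral_cos_mul_cos (hm.trans hk),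
    if_neg hjk, if_neg hjk]
  simp

/-- The polynomial has harmonics below `m` only, the kernel from `m` on. This is why the best
approximation of `φ`, and not its norm, enters the bound. -/
lemma integral_trigPoly_mul_devKernel {q : ℝ} (hq : 0 < q) (hq1 : q < 1) (γ : ℝ) {m : ℕ}
    (hm : 1 ≤ m) (p : ℕ) (a b : ℕ → ℝ) (x : ℝ) :
    ∫ t, trigPoly m a b t * devKernel q γ m p (x - t) ∂periodMeasure = 0 := by
  have h := hasSum_integral_mul_devKernel hq hq1 γ hm p
    (integrable_of_continuous_periodic (continuous_trigPoly m a b) (periodic_trigPoly m a b)) x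
  simp_rw [fourierPhase_trigPoly hm (Nat.le_add_right m _), mul_zero] at h
  have h2 := h.unique hasSum_zero
  simpa [pi_ne_zero] using h2

lemma abs_integral_mul_le {s u : ℝ≥0∞} [hsu : s.HolderConjugate u] {φ N : ℝ → ℝ}
    (hφ : MemLp φ s periodMeasure) (hN : MemLp N u periodMeasure) :
    |∫ t, φ t * N t ∂periodMeasure| ≤ normL s φ * normL u N := by
  have h := eLpNorm_smul_le_mul_eLpNorm (p := s) (q := u) (r := 1) hN.1 hφ.1
  have h2 := ENNReal.toReal_mono (ENNReal.mul_ne_top hφ.2.ne hN.2.ne) h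
  rw [ENNReal.toReal_mul, toReal_eLpNorm_one (hφ.1.smul hN.1)] at h2
  refine le_trans ?_ h2
  simpa using norm_integral_le_integral_norm (μ := periodMeasure) (fun t => φ t * N t)

lemma bestApprox_set_nonempty (m : ℕ) (s : ℝ≥0∞) (φ : ℝ → ℝ) :
    {r : ℝ | ∃ a b : ℕ → ℝ, r = normL s (fun x => φ x - trigPoly m a b x)}.Nonempty :=
  ⟨_, 0, 0, rfl⟩

lemma bestApprox_le (m : ℕ) (s : ℝ≥0∞) (φ : ℝ → ℝ) (a b : ℕ → ℝ) :
    bestApprox m s φ ≤ normL s (fun x => φ x - trigPoly m a b x) := by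
  refine csInf_le ⟨0, ?_⟩ ⟨a, b, rfl⟩
  rintro r ⟨a, b, rfl⟩
  exact ENNReal.toReal_nonneg

lemma le_bestApprox {m : ℕ} {s : ℝ≥0∞} {φ : ℝ → ℝ} {B : ℝ}
    (h : ∀ a b, B ≤ normL s (fun x => φ x - trigPoly m a b x)) : B ≤ bestApprox m s φ := by
  refine le_csInf (bestApprox_set_nonempty m s φ) ?_
  rintro r ⟨a, b, rfl⟩
  exact h a b

lemma bestApprox_nonneg (m : ℕ) (s : ℝ≥0∞) (φ : ℝ → ℝ) : 0 ≤ bestApprox m s φ :=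
  le_bestApprox fun _ _ => ENNReal.toReal_nonneg

lemma bestApprox_le_normL (m : ℕ) (s : ℝ≥0∞) (φ : ℝ → ℝ) : bestApprox m s φ ≤ normL s φ := by
  refine (bestApprox_le m s φ 0 0).trans_eq ?_
  simp [trigPoly]

lemma normL_const_mul {c : ℝ} (hc : 0 ≤ c) (s : ℝ≥0∞) (f : ℝ → ℝ) :
    normL s (fun t => c * f t) = c * normL s f := by
  unfold normL
  rw [show (fun t => c * f t) = c • f from rfl, eLpNorm_const_smul, ENNReal.toReal_mul,
    toReal_enorm, Real.norm_of_nonneg hc]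

lemma bestApprox_affine_le {m : ℕ} (hm : 1 ≤ m) (s : ℝ≥0∞) (φ : ℝ → ℝ) {c : ℝ} (hc : 0 < c)
    (d : ℝ) : bestApprox m s (fun t => c * φ t - d) ≤ c * bestApprox m s φ := by
  rw [mul_comm, ← div_le_iff₀ hc]
  refine le_bestApprox fun a b => ?_
  rw [div_le_iff₀ hc, mul_comm, ← normL_const_mul hc.le]
  refine (bestApprox_le m s _ (fun k => c * a k - if k = 0 then d else 0)
    (fun k => c * b k)).trans_eq ?_
  congr 1
  funext t
  have : trigPoly m (fun k => c * a k - if k = 0 then d else 0) (fun k => c * b k) t =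
      c * trigPoly m a b t - d := by
    unfold trigPoly
    have h : ∀ k ∈ Finset.range m, ((c * a k - if k = 0 then d else 0) * cos (k * t) +
        c * b k * sin (k * t)) = c * (a k * cos (k * t) + b k * sin (k * t)) -
          if k = 0 then d else 0 := by
      intro k _
      split_ifs with hk
      · subst hk; simp
      · ring
    rw [Finset.sum_congr rfl h, Finset.sum_sub_distrib, ← Finset.mul_sum, Finset.sum_ite_eq',
      if_pos (Finset.mem_range.2 (by omega))]
  rw [this]; ring

/-- Constants are admissible polynomials because `m ≥ 1`, so `d` is absorbed; the reverse inequality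
is the direct one applied to the inverse affine map. -/
lemma bestApprox_affine {m : ℕ} (hm : 1 ≤ m) (s : ℝ≥0∞) (φ : ℝ → ℝ) {c : ℝ} (hc : 0 < c)
    (d : ℝ) : bestApprox m s (fun t => c * φ t - d) = c * bestApprox m s φ := by
  refine le_antisymm (bestApprox_affine_le hm s φ hc d) ?_
  have h := bestApprox_affine_le hm s (fun t => c * φ t - d) (inv_pos.2 hc) (-(c⁻¹ * d))
  have h2 : (fun t => c⁻¹ * (c * φ t - d) - -(c⁻¹ * d)) = φ := by
    funext t; field_simp; ring
  rw [h2, inv_mul_eq_div, le_div_iff₀ hc] at h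
  linarith

lemma continuous_devKernel_sub {q : ℝ} (hq : 0 < q) (hq1 : q < 1) (γ : ℝ) {m : ℕ} (hm : 1 ≤ m)
    (p : ℕ) (x : ℝ) : Continuous fun t => devKernel q γ m p (x - t) :=
  (continuous_devKernel hq hq1 γ hm p).comp (by fun_prop)

lemma periodic_devKernel_sub (q γ : ℝ) (m p : ℕ) (x : ℝ) :
    Function.Periodic (fun t => devKernel q γ m p (x - t)) (2 * π) :=
  (periodic_devKernel q γ m p).const_sub x

lemma abs_integral_mul_devKernel_le {q : ℝ} (hq : 0 < q) (hq1 : q < 1) (γ : ℝ) {m : ℕ}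
    (hm : 1 ≤ m) (p : ℕ) {s u : ℝ≥0∞} [hsu : s.HolderConjugate u] {φ : ℝ → ℝ}
    (hφ : MemLp φ s periodMeasure) (x : ℝ) :
    |∫ t, φ t * devKernel q γ m p (x - t) ∂periodMeasure| ≤
      normL u (devKernel q γ m p) * bestApprox m s φ := by
  have hs : 1 ≤ s := ENNReal.HolderConjugate.one_le s u
  have hK := continuous_devKernel_sub hq hq1 γ hm p x
  have hKp := periodic_devKernel_sub q γ m p x
  have hKu := memLp_of_continuous_periodic hK hKp u
  have hnorm : normL u (fun t => devKernel q γ m p (x - t)) = normL u (devKernel q γ m p) := by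
    unfold normL
    rw [eLpNorm_sub_left (continuous_devKernel hq hq1 γ hm p) (periodic_devKernel q γ m p)]
  have hle : ∀ a b, |∫ t, φ t * devKernel q γ m p (x - t) ∂periodMeasure| ≤
      normL u (devKernel q γ m p) * normL s (fun t => φ t - trigPoly m a b t) := by
    intro a b
    have hT := continuous_trigPoly m a b
    have hTp := periodic_trigPoly m a b
    have h1 := abs_integral_mul_le (u := u)
      (hφ.sub (memLp_of_continuous_periodic hT hTp s)) hKu
    rw [hnorm, mul_comm (normL s _)] at h1
    refine le_trans (le_of_eq ?_) h1
    congr 1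
    simp only [Pi.sub_apply, sub_mul]
    rw [integral_sub (integrable_mul_of_continuous_periodic (hφ.integrable hs) hK hKp)
      (integrable_mul_of_continuous_periodic (integrable_of_continuous_periodic hT hTp) hK hKp),
      integral_trigPoly_mul_devKernel hq hq1 γ hm, sub_zero]
  have hN0 : 0 ≤ normL u (devKernel q γ m p) := ENNReal.toReal_nonneg
  -- Passing to the infimum divides by the norm of the kernel, so a zero norm is set apart.
  rcases hN0.eq_or_lt with h0 | hpos
  · have := hle 0 0
    rw [← h0, zero_mul] at this ⊢
    exact this
  · rw [mul_comm, ← div_le_iff₀ hpos]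
    refine le_bestApprox fun a b => ?_
    rw [div_le_iff₀ hpos, mul_comm]
    exact hle a b

/-! ### Duality: near-extremal functions. -/

/-- For `s = 1` an exact extremal function need not exist. The mass is spread evenly, with the sign
of `N`, over the set where `|N|` exceeds the norm minus `ε`; this loss is the source of `ε` below.
-/
lemma exists_dual_of_eq_top {N : ℝ → ℝ} (hN : Continuous N) (hNp : Function.Periodic N (2 * π))
    {ε : ℝ} (hε : 0 < ε) (hpos : 0 < normL ∞ N - ε) :
    ∃ φ, MemL 1 φ ∧ normL 1 φ ≤ 1 ∧ normL ∞ N - ε ≤ ∫ t, φ t * N t ∂periodMeasure := by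
  set c := normL ∞ N - ε with hc
  set B : Set ℝ := {t | c < |N t|} with hB
  have hBm : MeasurableSet B := (isOpen_lt continuous_const hN.abs).measurableSet
  have hμ : 0 < periodMeasure.real B := by
    rw [measureReal_def, ENNReal.toReal_pos_iff]
    refine ⟨pos_iff_ne_zero.2 fun h0 => ?_, measure_lt_top _ _⟩
    have hae : ∀ᵐ t ∂periodMeasure, ‖N t‖ ≤ c := by
      rw [ae_iff]
      simpa [hB] using h0
    have h1 : normL ∞ N ≤ c := by
      unfold normL
      rw [eLpNorm_exponent_top]
      exact ENNReal.toReal_le_of_le_ofReal hpos.le (eLpNormEssSup_le_of_ae_bound hae)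
    linarith
  set v := periodMeasure.real B with hv
  set φ : ℝ → ℝ := B.indicator fun t => v⁻¹ * (N t / |N t|) with hφ
  have hmeas : Measurable φ :=
    (measurable_const.mul (hN.measurable.div hN.abs.measurable)).indicator hBm
  have hnorm : ∀ t, ‖φ t‖ = B.indicator (fun _ => v⁻¹) t := by
    intro t
    by_cases ht : t ∈ B
    · have hNt : |N t| ≠ 0 := (hpos.trans ht).ne'
      rw [hφ, Set.indicator_of_mem ht, Set.indicator_of_mem ht, norm_mul, norm_div,
        Real.norm_eq_abs (N t), norm_abs_eq_norm, Real.norm_eq_abs (N t), div_self hNt, mul_one,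
        Real.norm_of_nonneg (inv_nonneg.2 hμ.le)]
    · rw [hφ, Set.indicator_of_notMem ht, Set.indicator_of_notMem ht, norm_zero]
  have hmem : MemLp φ 1 periodMeasure :=
    MemLp.of_bound hmeas.aestronglyMeasurable v⁻¹ (.of_forall fun t => by
      rw [hnorm]; exact Set.indicator_le_self' (fun _ _ => inv_nonneg.2 hμ.le) t)
  have hint : ∫ t, B.indicator (fun _ => v⁻¹) t ∂periodMeasure = 1 := by
    rw [integral_indicator hBm, setIntegral_const, smul_eq_mul, mul_inv_cancel₀ hμ.ne']
  refine ⟨φ, ⟨fun t => ?_, hmem⟩, ?_, ?_⟩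
  · simp only [hφ, Set.indicator, hB, Set.mem_ofPred_eq, hNp t]
  · unfold normL
    rw [toReal_eLpNorm_one hmem.1]
    simp_rw [hnorm]
    exact hint.le
  · calc c = ∫ t, c * B.indicator (fun _ => v⁻¹) t ∂periodMeasure := by
          rw [integral_const_mul, hint, mul_one]
      _ ≤ ∫ t, φ t * N t ∂periodMeasure := by
          refine integral_mono (((integrable_const _).indicator hBm).const_mul _)
            (integrable_mul_of_continuous_periodic (hmem.integrable le_rfl) hN hNp) fun t => ?_
          by_cases ht : t ∈ B
          · have hNt : 0 < |N t| := hpos.trans ht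
            simp only [hφ, Set.indicator_of_mem ht]
            have h2 : v⁻¹ * (N t / |N t|) * N t = |N t| * v⁻¹ := by
              field_simp
              rw [sq_abs]
            rw [h2]
            exact mul_le_mul_of_nonneg_right (le_of_lt ht) (inv_nonneg.2 hμ.le)
          · simp [hφ, Set.indicator_of_notMem ht]

/-- For `u > 1` it is the relation `s(u-1) = u` between conjugate exponents; for `u = 1` the
exponent is zero, `s = ∞` and both sides reduce to `1`. -/
lemma eLpNorm_rpow_sub_one {s u : ℝ≥0∞} [hsu : s.HolderConjugate u] (hu : u ≠ ∞) (N : ℝ → ℝ) :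
    eLpNorm (fun t => |N t| ^ (u.toReal - 1)) s periodMeasure ≤
      eLpNorm N u periodMeasure ^ (u.toReal - 1) := by
  have hu1 : 1 ≤ u := ENNReal.HolderConjugate.one_le u s
  rcases hu1.eq_or_lt with h1 | h1
  · subst h1
    have hs : s = ∞ := by
      have := ENNReal.HolderConjugate.inv_add_inv_eq_one s 1
      rw [inv_one] at this
      have h0 : s⁻¹ = 0 :=
        (ENNReal.add_left_inj ENNReal.one_ne_top).1 (this.trans (zero_add 1).symm)
      exact ENNReal.inv_eq_zero.1 h0
    subst hs
    simp only [ENNReal.toReal_one, sub_self, rpow_zero, ENNReal.rpow_zero]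
    rw [eLpNorm_exponent_top]
    simpa using eLpNormEssSup_le_of_ae_bound (C := 1) (f := fun _ : ℝ => (1 : ℝ))
      (μ := periodMeasure) (.of_forall fun t => by simp)
  · have hs : s ≠ ∞ := by
      rintro rfl
      have := ENNReal.HolderConjugate.inv_add_inv_eq_one ∞ u
      rw [ENNReal.inv_top, zero_add, ENNReal.inv_eq_one] at this
      exact h1.ne' this
    have hr : 1 < u.toReal := by
      rw [← ENNReal.toReal_one]; exact (ENNReal.toReal_lt_toReal ENNReal.one_ne_top hu).2 h1
    have hc : s.toReal.HolderConjugate u.toReal :=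
      ENNReal.HolderConjugate.toReal_of_ne_top hs hu
    have h2 := eLpNorm_norm_rpow (μ := periodMeasure) (p := s) N (sub_pos.2 hr)
    simp only [Real.norm_eq_abs] at h2
    rw [h2]
    have h3 : s * ENNReal.ofReal (u.toReal - 1) = u := by
      rw [← ENNReal.ofReal_toReal hs, ← ENNReal.ofReal_mul ENNReal.toReal_nonneg, mul_comm,
        hc.symm.sub_one_mul_conj, ENNReal.ofReal_toReal hu]
    rw [h3]

lemma exists_dual_of_ne_top {s u : ℝ≥0∞} [hsu : s.HolderConjugate u] (hu : u ≠ ∞) {N : ℝ → ℝ}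
    (hN : Continuous N) (hNp : Function.Periodic N (2 * π)) (hpos : 0 < normL u N) :
    ∃ φ, MemL s φ ∧ normL s φ ≤ 1 ∧ normL u N ≤ ∫ t, φ t * N t ∂periodMeasure := by
  have hu1 : 1 ≤ u := ENNReal.HolderConjugate.one_le u s
  have hu0 : u ≠ 0 := (zero_lt_one.trans_le hu1).ne'
  have hr : 1 ≤ u.toReal := by
    rw [← ENNReal.toReal_one]; exact ENNReal.toReal_mono hu hu1
  have hr0 : 0 < u.toReal := by linarith
  set r := u.toReal with hrdef
  have hNu := memLp_of_continuous_periodic hN hNp u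
  set v := normL u N ^ (r - 1) with hv
  have hv0 : 0 < v := rpow_pos_of_pos hpos _
  -- This is the equality case of Hölder's inequality; at `u = 1` the power is `1` and `φ₀` is the
  -- sign of `N`.
  set φ₀ : ℝ → ℝ := fun t => Real.sign (N t) * |N t| ^ (r - 1) with hφ₀
  have hsgn : Measurable Real.sign :=
    Measurable.ite measurableSet_Iio measurable_const
      (Measurable.ite measurableSet_Ioi measurable_const measurable_const)
  have hmeas : Measurable φ₀ :=
    (hsgn.comp hN.measurable).mul (hN.abs.measurable.pow_const _)
  have habs : ∀ x : ℝ, |Real.sign x| ≤ 1 := by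
    intro x
    rcases Real.sign_apply_eq x with h | h | h <;> simp [h]
  have hle : eLpNorm φ₀ s periodMeasure ≤ eLpNorm N u periodMeasure ^ (r - 1) := by
    refine (eLpNorm_mono fun t => ?_).trans (eLpNorm_rpow_sub_one (s := s) hu N)
    rw [hφ₀, norm_mul]
    exact mul_le_of_le_one_left (norm_nonneg _) (habs _)
  have hfin : eLpNorm N u periodMeasure ^ (r - 1) ≠ ⊤ :=
    ENNReal.rpow_ne_top_of_nonneg (by linarith) hNu.2.ne
  have hmem : MemLp φ₀ s periodMeasure :=
    ⟨hmeas.aestronglyMeasurable, hle.trans_lt hfin.lt_top⟩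
  refine ⟨fun t => v⁻¹ * φ₀ t, ⟨fun t => ?_, hmem.const_mul _⟩, ?_, ?_⟩
  · simp only [hφ₀, hNp t]
  · rw [normL_const_mul (inv_nonneg.2 hv0.le), inv_mul_le_iff₀ hv0, mul_one]
    have := ENNReal.toReal_mono hfin hle
    rwa [← ENNReal.toReal_rpow] at this
  · have hpt : ∀ t, v⁻¹ * φ₀ t * N t = v⁻¹ * ‖N t‖ ^ r := by
      intro t
      have h1 : Real.sign (N t) * N t = |N t| := by
        rcases lt_trichotomy (N t) 0 with h | h | h
        · rw [Real.sign_of_neg h, abs_of_neg h]; ring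
        · simp [h]
        · rw [Real.sign_of_pos h, abs_of_pos h]; ring
      have h2 : |N t| ^ r = |N t| ^ (r - 1) * |N t| := by
        rcases eq_or_ne (N t) 0 with h | h
        · simp [h, hr0.ne']
        · rw [← rpow_add_one (abs_ne_zero.2 h), sub_add_cancel]
      simp only [hφ₀, Real.norm_eq_abs]
      rw [h2]
      linear_combination (v⁻¹ * |N t| ^ (r - 1)) * h1
    simp_rw [hpt]
    rw [integral_const_mul]
    have h3 : normL u N ^ r = ∫ t, ‖N t‖ ^ r ∂periodMeasure := by
      have h0 : 0 ≤ ∫ t, ‖N t‖ ^ r ∂periodMeasure := integral_nonneg fun t => by positivity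
      unfold normL
      rw [MemLp.eLpNorm_eq_integral_rpow_norm hu0 hu hNu, ENNReal.toReal_ofReal (by positivity),
        ← rpow_mul h0, inv_mul_cancel₀ hr0.ne', rpow_one]
    rw [← h3, hv, inv_mul_eq_div, ← rpow_sub hpos]
    simp

/-- Near-extremal functions in Hölder's inequality. -/
theorem exists_dual {s u : ℝ≥0∞} [hsu : s.HolderConjugate u] {N : ℝ → ℝ}
    (hN : Continuous N) (hNp : Function.Periodic N (2 * π)) {ε : ℝ} (hε : 0 < ε)
    (hpos : 0 < normL u N - ε) :
    ∃ φ, MemL s φ ∧ normL s φ ≤ 1 ∧ normL u N - ε ≤ ∫ t, φ t * N t ∂periodMeasure := by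
  rcases eq_or_ne u ∞ with rfl | hu
  · have hs : s = 1 := by
      have := ENNReal.HolderConjugate.inv_add_inv_eq_one s ∞
      rwa [ENNReal.inv_top, add_zero, ENNReal.inv_eq_one] at this
    subst hs
    exact exists_dual_of_eq_top hN hNp hε hpos
  · obtain ⟨φ, h1, h2, h3⟩ := exists_dual_of_ne_top (s := s) hu hN hNp (by linarith)
    exact ⟨φ, h1, h2, by linarith⟩

/-! ### Two-sided bounds of the deviation by the norm of the kernel. -/

lemma normC_nonneg (f : ℝ → ℝ) : 0 ≤ normC f := Real.iSup_nonneg fun _ => abs_nonneg _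

lemma normC_deviation_le {q : ℝ} (hq : 0 < q) (hq1 : q < 1) {β : ℝ} {s u : ℝ≥0∞}
    [hsu : s.HolderConjugate u] {n p : ℕ} (hp : 1 ≤ p) (hpn : p ≤ n) {f φ : ℝ → ℝ}
    (hf : MemCPsi (neumann q) β s f φ) :
    BddAbove (Set.range fun x => |deviation n p f x|) ∧
    normC (deviation n p f) ≤ 1 / p *
      (1 / π * normL u (devKernel q (β * π / 2) (n - p + 1) p)) * bestApprox (n - p + 1) s φ := by
  have h : ∀ x, |deviation n p f x| ≤ 1 / p *
      (1 / π * normL u (devKernel q (β * π / 2) (n - p + 1) p)) *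
        bestApprox (n - p + 1) s φ := by
    intro x
    rw [deviation_eq_integral hq hq1 hf.1 hf.2.1 hp hpn x, abs_mul, abs_mul,
      abs_of_nonneg (by positivity : (0 : ℝ) ≤ 1 / p), abs_of_pos (by positivity : 0 < 1 / π),
      mul_assoc, mul_assoc (1 / π)]
    have := abs_integral_mul_devKernel_le (u := u) hq hq1 (β * π / 2)
      (Nat.le_add_left 1 (n - p)) p hf.2.2.2 x
    gcongr
  exact ⟨⟨_, Set.forall_mem_range.2 h⟩, ciSup_le h⟩

/-- Sharpness of the bound by the norm of the kernel. -/
theorem exists_deviation_ge {q : ℝ} (hq : 0 < q) (hq1 : q < 1) {β : ℝ} {s u : ℝ≥0∞}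
    [hsu : s.HolderConjugate u] {n p : ℕ} (hp : 1 ≤ p) (hpn : p ≤ n) {f φ : ℝ → ℝ}
    (hf : MemCPsi (neumann q) β s f φ) {ε : ℝ} (hε : 0 < ε) :
    ∃ F Φ, MemCPsi (neumann q) β s F Φ ∧
      bestApprox (n - p + 1) s Φ = bestApprox (n - p + 1) s φ ∧
      1 / p * (1 / π * (normL u (devKernel q (β * π / 2) (n - p + 1) p) - ε)) *
        bestApprox (n - p + 1) s φ ≤ normC (deviation n p F) := by
  set m := n - p + 1 with hm_def
  have hm : 1 ≤ m := Nat.le_add_left 1 (n - p)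
  set γ := β * π / 2 with hγ
  set E := bestApprox m s φ with hE
  have hE0 : 0 ≤ E := bestApprox_nonneg m s φ
  have hs : 1 ≤ s := ENNReal.HolderConjugate.one_le s u
  set N : ℝ → ℝ := fun t => devKernel q γ m p (0 - t) with hN_def
  have hN := continuous_devKernel_sub hq hq1 γ hm p 0
  have hNp := periodic_devKernel_sub q γ m p 0
  have hnorm : normL u N = normL u (devKernel q γ m p) := by
    unfold normL
    rw [eLpNorm_sub_left (continuous_devKernel hq hq1 γ hm p) (periodic_devKernel q γ m p)]
  rw [← hnorm]
  have hp0 : (0 : ℝ) < p := by exact_mod_cast hp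
  have hpi := pi_pos
  -- In these cases the lower bound is nonpositive and `f` itself serves.
  by_cases htriv : E = 0 ∨ normL u N - ε ≤ 0
  · refine ⟨f, φ, hf, rfl, le_trans ?_ (normC_nonneg _)⟩
    rcases htriv with h | h
    · rw [h, mul_zero]
    · refine mul_nonpos_of_nonpos_of_nonneg (mul_nonpos_of_nonneg_of_nonpos (by positivity)
        (mul_nonpos_of_nonneg_of_nonpos (by positivity) h)) hE0
  · push Not at htriv
    obtain ⟨hE1, hpos⟩ := htriv
    obtain ⟨φ₀, hφ₀, hn, hI⟩ := exists_dual (s := s) hN hNp hε hpos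
    set I := ∫ t, φ₀ t * N t ∂periodMeasure with hI_def
    have hI0 : 0 < I := hpos.trans_le hI
    set E₀ := bestApprox m s φ₀ with hE₀
    have hE₀1 : E₀ ≤ 1 := (bestApprox_le_normL m s φ₀).trans hn
    -- If `φ₀` had best approximation zero, its integral against the kernel would vanish.
    have hE₀0 : 0 < E₀ := by
      refine lt_of_le_of_ne (bestApprox_nonneg m s φ₀) fun h => ?_
      have := abs_integral_mul_devKernel_le (u := u) hq hq1 γ hm p hφ₀.2 0
      rw [← hE₀, ← h, mul_zero] at this
      exact absurd ((le_abs_self I).trans this) (not_le.2 hI0)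
    -- The scaling that gives the prescribed best approximation; since `E₀ ≤ 1`, it is at least `E`,
    -- which only helps the lower bound.
    set c := E / E₀ with hc
    have hEpos : 0 < E := lt_of_le_of_ne hE0 (Ne.symm hE1)
    have hc0 : 0 < c := div_pos hEpos hE₀0
    have hcE : E ≤ c := by
      rw [hc, le_div_iff₀ hE₀0]; exact mul_le_of_le_one_right hE0 hE₀1
    -- Removing the mean value makes the function a derivative and changes neither the best
    -- approximation nor the integral against the kernel.
    set d := c * fourierA φ₀ 0 / 2 with hd
    have hmem : MemL s fun t => c * φ₀ t - d :=
      ⟨fun t => by simp only [hφ₀.1 t], (hφ₀.2.const_mul c).sub (memLp_const d)⟩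
    have hint : Integrable φ₀ periodMeasure := hφ₀.2.integrable hs
    have hmean : fourierA (fun t => c * φ₀ t - d) 0 = 0 := by
      rw [fourierA_eq_phase, fourierPhase_sub (hint.const_mul c) (integrable_const d),
        ← fourierA_eq_phase, ← fourierA_eq_phase, fourierA_const, hd]
      have : fourierA (fun t => c * φ₀ t) 0 = c * fourierA φ₀ 0 := by
        rw [fourierA_eq, fourierA_eq]
        simp_rw [mul_assoc c]
        rw [integral_const_mul]
        ring
      rw [this]; ring
    have hF := memCPsi_psiIntegral hq hq1 β hs hmem hmean
    refine ⟨_, _, hF, ?_, ?_⟩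
    · rw [bestApprox_affine hm s φ₀ hc0, ← hE₀, hc, div_mul_cancel₀ _ hE₀0.ne']
    · obtain ⟨hbdd, -⟩ := normC_deviation_le (u := u) hq hq1 hp hpn hF
      refine le_trans ?_ (le_ciSup hbdd 0)
      refine le_trans ?_ (le_abs_self _)
      rw [deviation_eq_integral hq hq1 hF.1 hF.2.1 hp hpn 0, mul_assoc, mul_assoc]
      gcongr
      have hconst : ∫ t, d * N t ∂periodMeasure = 0 := by
        have h := integral_trigPoly_mul_devKernel hq hq1 γ hm p
          (fun k => if k = 0 then d else 0) 0 0
        have ht : ∀ t, trigPoly m (fun k => if k = 0 then d else 0) 0 t = d := by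
          intro t
          unfold trigPoly
          rw [Finset.sum_eq_single_of_mem 0 (Finset.mem_range.2 (by omega))
            (fun k _ hk => by simp [hk])]
          simp
        simp_rw [ht] at h
        exact h
      have hval : ∫ t, (c * φ₀ t - d) * N t ∂periodMeasure = c * I := by
        simp_rw [sub_mul, mul_assoc c]
        rw [integral_sub ((integrable_mul_of_continuous_periodic hint hN hNp).const_mul c)
          ((integrable_of_continuous_periodic hN hNp).const_mul d), hconst, integral_const_mul,
          sub_zero]
      change _ ≤ ∫ t, (c * φ₀ t - d) * N t ∂periodMeasure
      rw [hval, mul_comm]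
      exact mul_le_mul hcE hI hpos.le hc0.le

/-! ### The ratio of consecutive coefficients. -/

/-- The ratio is `qk/(k+1)`, at distance `q/(k+1)` from `q`; this decreases in `k`, so the supremum
is attained at `k = m`. -/
lemma isLUB_neumann_ratio {q : ℝ} (hq : 0 < q) {m : ℕ} (hm : 1 ≤ m) :
    IsLUB {e : ℝ | ∃ k : ℕ, m ≤ k ∧ e = |neumann q (k + 1) / neumann q k - q|}
      (q / ((m : ℝ) + 1)) := by
  have hval : ∀ k : ℕ, m ≤ k → |neumann q (k + 1) / neumann q k - q| = q / ((k : ℝ) + 1) := by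
    intro k hk
    have hk0 : (0 : ℝ) < k := by exact_mod_cast (by omega : 0 < k)
    have h : neumann q (k + 1) / neumann q k - q = -(q / ((k : ℝ) + 1)) := by
      unfold neumann
      rw [pow_succ]
      push_cast
      field_simp
      ring
    rw [h, abs_neg, abs_of_pos (by positivity)]
  refine IsGreatest.isLUB ⟨⟨m, le_rfl, (hval m le_rfl).symm⟩, ?_⟩
  rintro e ⟨k, hk, rfl⟩
  rw [hval k hk]
  have : (m : ℝ) ≤ k := by exact_mod_cast hk
  gcongr

end VallePoussin

end

theorem mainTheorem7 :
    (∀ q : ℝ, 0 < q → q < 1 → ∀ m : ℕ, 1 ≤ m →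
      IsLUB {e : ℝ | ∃ k : ℕ, m ≤ k ∧
          e = |VallePoussin.neumann q (k + 1) / VallePoussin.neumann q k - q|}
        (q / ((m : ℝ) + 1))) ∧
    ∃ A : ℝ, 0 < A ∧
      ∀ (q β : ℝ) (s : ℝ≥0∞) (n p : ℕ), 0 < q → q < 1 → 1 ≤ s → 1 ≤ p → p ≤ n →
      ∀ f φ : ℝ → ℝ, VallePoussin.MemCPsi (VallePoussin.neumann q) β s f φ →
        VallePoussin.normC (VallePoussin.deviation n p f) ≤
            q ^ (n - p + 1) / ((p : ℝ) * ((n - p + 1 : ℕ) : ℝ)) *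
              (VallePoussin.mainConst q p (ENNReal.conjExponent s) +
                A * VallePoussin.remainder q n p s) *
              VallePoussin.bestApprox (n - p + 1) s φ ∧
        ∃ F Φ : ℝ → ℝ, VallePoussin.MemCPsi (VallePoussin.neumann q) β s F Φ ∧
          VallePoussin.bestApprox (n - p + 1) s Φ = VallePoussin.bestApprox (n - p + 1) s φ ∧
          ∃ θ : ℝ, |θ| ≤ A ∧
            VallePoussin.normC (VallePoussin.deviation n p F) =
              q ^ (n - p + 1) / ((p : ℝ) * ((n - p + 1 : ℕ) : ℝ)) *
                (VallePoussin.mainConst q p (ENNReal.conjExponent s) +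
                  θ * VallePoussin.remainder q n p s) *
                VallePoussin.bestApprox (n - p + 1) s Φ := by
  -- The constant is `33 = 32 + 1`: `32` for the norm of the kernel and `1` for the defect `ε` of
  -- the near-extremal function.
  refine ⟨fun q hq _ m hm => VallePoussin.isLUB_neumann_ratio hq hm, 33, by norm_num, ?_⟩
  intro q β s n p hq hq1 hs hp hpn f φ hf
  have : s.HolderConjugate (ENNReal.conjExponent s) := .conjExponent hs
  have hm : 1 ≤ n - p + 1 := Nat.le_add_left 1 (n - p)
  have hK := VallePoussin.abs_normL_devKernel_sub_le hq hq1 hm hp (β * π / 2) hs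
  change |_ - _| ≤ _ * (32 * VallePoussin.remainder q n p s) at hK
  have h1q : 0 < 1 - q := by linarith
  have hp0 : (0 : ℝ) < p := by exact_mod_cast hp
  -- The second term keeps the remainder positive even for `s = 2`, so `θ` can be found by dividing
  -- by it.
  have hR : 0 < VallePoussin.remainder q n p s := by
    have hδ : 0 ≤ VallePoussin.deltaS s := by
      unfold VallePoussin.deltaS; split_ifs <;> norm_num
    unfold VallePoussin.remainder
    have hmin : 0 < min (p : ℝ) (1 / (1 - q)) := lt_min hp0 (by positivity)
    positivity
  have hm0 : (0 : ℝ) < ((n - p + 1 : ℕ) : ℝ) := by positivity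
  set R := VallePoussin.remainder q n p s
  set K := VallePoussin.mainConst q p (ENNReal.conjExponent s)
  set m := n - p + 1
  set a := q ^ m / (m : ℝ) with ha
  have ha0 : 0 < a := by positivity
  have hcoef : q ^ m / ((p : ℝ) * (m : ℝ)) = 1 / p * a := by rw [ha]; field_simp
  rw [hcoef]
  have hup : ∀ {F Φ}, VallePoussin.MemCPsi (VallePoussin.neumann q) β s F Φ →
      VallePoussin.normC (VallePoussin.deviation n p F) ≤
        1 / p * a * (K + 33 * R) * VallePoussin.bestApprox m s Φ := by
    intro F Φ hF
    refine (VallePoussin.normC_deviation_le (u := ENNReal.conjExponent s)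
      hq hq1 hp hpn hF).2.trans ?_
    have h0 := VallePoussin.bestApprox_nonneg m s Φ
    rw [mul_assoc (1 / (p : ℝ)) a]
    refine mul_le_mul_of_nonneg_right (mul_le_mul_of_nonneg_left ?_ (by positivity)) h0
    have := (abs_le.1 hK).2
    have : 0 < a * R := by positivity
    linarith
  refine ⟨hup hf, ?_⟩
  -- After the factor `1/π`, this `ε` costs exactly one more `a * R`.
  obtain ⟨F, Φ, hF, hE, hge⟩ := VallePoussin.exists_deviation_ge
    (u := ENNReal.conjExponent s) hq hq1 hp hpn hf (ε := π * (a * R)) (by positivity)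
  refine ⟨F, Φ, hF, hE, ?_⟩
  have hupF := hup hF
  rw [hE] at hupF ⊢
  set E := VallePoussin.bestApprox m s φ
  set X := VallePoussin.normC (VallePoussin.deviation n p F)
  have hE0 : 0 ≤ E := VallePoussin.bestApprox_nonneg m s φ
  -- With zero best approximation the deviation of `F` vanishes and any `θ` works.
  rcases hE0.eq_or_lt with h0 | hEpos
  · refine ⟨0, by norm_num, ?_⟩
    rw [← h0, mul_zero] at hupF ⊢
    exact le_antisymm hupF (VallePoussin.normC_nonneg _)
  · have hD : 0 < 1 / p * a * E := by positivity
    have hlow : 1 / p * a * (K - 33 * R) * E ≤ X := by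
      refine le_trans ?_ hge
      rw [mul_assoc (1 / (p : ℝ)) a]
      refine mul_le_mul_of_nonneg_right (mul_le_mul_of_nonneg_left ?_ (by positivity)) hE0
      have h1 := (abs_le.1 hK).1
      have h2 : 1 / π * (π * (a * R)) = a * R := by field_simp
      rw [mul_sub, mul_sub (1 / π), h2]
      linarith
    -- The desired equality solved for `θ`; the bounds `K ± 33 R` translate into `|θ| ≤ 33`.
    refine ⟨(X / (1 / p * a * E) - K) / R, ?_, ?_⟩
    · rw [abs_le]
      constructor
      · rw [le_div_iff₀ hR]
        have : K - 33 * R ≤ X / (1 / p * a * E) := by rw [le_div_iff₀ hD]; linarith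
        linarith
      · rw [div_le_iff₀ hR]
        have : X / (1 / p * a * E) ≤ K + 33 * R := by rw [div_le_iff₀ hD]; linarith
        linarith
    · rw [div_mul_cancel₀ _ hR.ne', add_sub_cancel]
      field_simp
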